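/- Let $(\Omega,\mathcal F,\mathbb P)$ be a nonatomic probability space, let $p\in[1,\infty]$ and $L^p=L^p(\Omega,\mathcal F,\mathbb P)$, where random variables represent losses. "Increasing" means non-decreasing, and (in)equalities between random variables hold almost surely. A law-invariant deviation measure is a functional $D:L^p\to[0,\infty)$ such that, for all $X,Y\in L^p$: $D(X+c)=D(X)$ for $c\in\mathbb R$; $D(X)>0$ if $X$ is not almost surely constant; $D(aX)=aD(X)$ for $a\ge 0$; $D(X+Y)\le D(X)+D(Y)$; and $D(X)=D(Y)$ if $X$ and $Y$ have the same distribution. It is range normalized if $$\sup\Big\{\frac{D(X)}{\operatorname{ess\,sup}X-\mathbb E[X]}\;:\;X\in L^p \text{ not a.s. constant}\Big\}=1,$$ where the ratio is $0$ when $\operatorname{ess\,sup}X=\infty$. A mean-deviation model with law-invariant deviation measure $D$ is a functional $U:L^p\to(-\infty,\infty]$ of the form $U(X)=V(\mathbb E[X],D(X))$, where $V:\mathbb R\times[0,\infty)\to(-\infty,\infty]$ is increasing in each argument, $V(m,0)=m$ for all $m\in\mathbb R$, and $V(m,d_1)\ne V(m,d_2)$ for some $m\in\mathbb R$, $d_1,d_2\ge0$.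 A functional $U:L^p\to(-\infty,\infty]$ is monotone if $U(X)\le U(Y)$ whenever $X\le Y$; cash additive if $U(X+c)=U(X)+c$ for all $X\in L^p$ and $c\in\mathbb R$; and SSD-consistent if $U(X)\le U(Y)$ whenever $\mathbb E[u(X)]\le\mathbb E[u(Y)]$ for all increasing convex $u:\mathbb R\to\mathbb R$ (expectations with values in $(-\infty,\infty]$). It is a monetary risk measure if it is monotone and cash additive, and a consistent risk measure if it is monetary and SSD-consistent. **Theorem.** Let $U:L^p\to(-\infty,\infty]$ be a mean-deviation model with law-invariant deviation measure $D$. The following are equivalent: (i) $U$ is a monetary risk measure. (ii) $U$ is a consistent risk measure. (iii) There are $\lambda>0$ such that $\lambda D$ is range normalized and a non-constant, increasing, $\lambda$-Lipschitz function $g:[0,\infty)\to\mathbb R$ with $g(0)=0$ such that $U(X)=g(D(X))+\mathbb E[X]$ for all $X\in L^p$. Moreover, if $U$ is monotone (not necessarily cash additive), then $U(X)<\infty$ for all $X\in L^p$, and $\lambda D$ is range normalized for some $\lambda>0$. -/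

import Mathlib

open MeasureTheory ProbabilityTheory
open scoped NNReal ENNReal

noncomputable section

namespace MeanDeviation

variable {Ω : Type*} [MeasurableSpace Ω]

/-- The measure `P` has no atoms: every measurable set of positive measure has a measurable subset
of strictly smaller positive measure.  (Mathlib's `NoAtoms` only says that points are null.) -/
def IsNonatomic (P : Measure Ω) : Prop :=
  ∀ A : Set Ω, MeasurableSet A → 0 < P A → ∃ B ⊆ A, MeasurableSet B ∧ 0 < P B ∧ P B < P A

variable (P : Measure Ω) [IsProbabilityMeasure P] {p : ℝ≥0∞}

/-- The expectation `𝔼[X]` of an element of `L^p`. -/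
def mean (X : Lp ℝ p P) : ℝ := ∫ ω, X ω ∂P

/-- The essential supremum of an element of `L^p`, with value `⊤` if it is not bounded above. -/
def esssup (X : Lp ℝ p P) : EReal := essSup (fun ω => ((X ω : ℝ) : EReal)) P

/-- `X` is not almost surely equal to a constant. -/
def IsNonconstant (X : Lp ℝ p P) : Prop := ∀ c : ℝ, X ≠ Lp.const p P c

/-- The expectation in the extended sense, `𝔼[f⁺] - 𝔼[f⁻]`. -/
def extendedMean (f : Ω → ℝ) : EReal :=
  ((∫⁻ ω, ENNReal.ofReal (f ω) ∂P : ℝ≥0∞) : EReal)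
    - ((∫⁻ ω, ENNReal.ofReal (-f ω) ∂P : ℝ≥0∞) : EReal)

/-- Second-order stochastic dominance for losses (increasing convex order): `𝔼[u(X)] ≤ 𝔼[u(Y)]` for
all increasing convex `u`.  For `p ≥ 1` the negative parts are integrable, since `u` has an affine
minorant, so both expectations are well defined in `(-∞, ∞]`. -/
def SSDLe (X Y : Lp ℝ p P) : Prop :=
  ∀ u : ℝ → ℝ, Monotone u → ConvexOn ℝ Set.univ u →
    extendedMean P (fun ω => u (X ω)) ≤ extendedMean P (fun ω => u (Y ω))

/-- Law-invariant deviation measures on `L^p`. -/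
structure IsDeviationMeasure (D : Lp ℝ p P → ℝ≥0) : Prop where
  add_const : ∀ (X : Lp ℝ p P) (c : ℝ), D (X + Lp.const p P c) = D X
  pos : ∀ X : Lp ℝ p P, IsNonconstant P X → 0 < D X
  smul : ∀ (a : ℝ≥0) (X : Lp ℝ p P), D ((a : ℝ) • X) = a * D X
  add_le : ∀ X Y : Lp ℝ p P, D (X + Y) ≤ D X + D Y
  law_invariant : ∀ X Y : Lp ℝ p P, IdentDistrib X Y P P → D X = D Y

/-- Range normalized law-invariant deviation measures: the supremum over nonconstant `X` of
`D(X) / (ess-sup X - 𝔼[X])` is `1`; the ratio is `0` if `ess-sup X = ∞`. -/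
structure IsRangeNormalized (D : Lp ℝ p P → ℝ≥0) : Prop where
  deviation : IsDeviationMeasure P D
  sup_eq_one : (⨆ (X : Lp ℝ p P) (_ : IsNonconstant P X),
    ((D X : ℝ) : EReal) / (esssup P X - (mean P X : EReal))) = 1

/-- The conditions on the bivariate function `V : ℝ × [0, ∞) → (-∞, ∞]` of a mean-deviation
model. -/
structure IsAggregator (V : ℝ → ℝ≥0 → WithTop ℝ) : Prop where
  mono_left : ∀ (d : ℝ≥0), Monotone (fun m => V m d)
  mono_right : ∀ (m : ℝ), Monotone (fun d => V m d)
  apply_zero : ∀ (m : ℝ), V m 0 = (m : WithTop ℝ)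
  depends_on_deviation : ∃ (m : ℝ) (d₁ d₂ : ℝ≥0), V m d₁ ≠ V m d₂

/-- `U : L^p → (-∞, ∞]` is a mean-deviation model with deviation measure `D`. -/
def IsMeanDeviationModel (D : Lp ℝ p P → ℝ≥0) (U : Lp ℝ p P → WithTop ℝ) : Prop :=
  IsDeviationMeasure P D ∧
    ∃ V : ℝ → ℝ≥0 → WithTop ℝ, IsAggregator V ∧ ∀ X, U X = V (mean P X) (D X)

/-- Monotonicity with respect to the almost sure order. -/
def IsMonotonic (U : Lp ℝ p P → WithTop ℝ) : Prop :=
  ∀ X Y : Lp ℝ p P, (∀ᵐ ω ∂P, X ω ≤ Y ω) → U X ≤ U Y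

/-- Cash additivity. -/
def IsCashAdditive (U : Lp ℝ p P → WithTop ℝ) : Prop :=
  ∀ (X : Lp ℝ p P) (c : ℝ), U (X + Lp.const p P c) = U X + (c : WithTop ℝ)

/-- Consistency with respect to second-order stochastic dominance. -/
def IsSSDConsistent (U : Lp ℝ p P → WithTop ℝ) : Prop :=
  ∀ X Y : Lp ℝ p P, SSDLe P X Y → U X ≤ U Y

/-- Monetary risk measures. -/
def IsMonetary (U : Lp ℝ p P → WithTop ℝ) : Prop :=
  IsMonotonic P U ∧ IsCashAdditive P U

/-- Consistent risk measures. -/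
def IsConsistent (U : Lp ℝ p P → WithTop ℝ) : Prop :=
  IsMonetary P U ∧ IsSSDConsistent P U

end MeanDeviation

end

/-!
For a nonconstant `Z` bounded above by `e`, some multiple `a Z + b` has any given deviation `d` and
any given mean `m`, and it is at most the constant `m + d (e - 𝔼[Z]) / D(Z)`. Monotonicity of `U`
therefore gives `V m d ≤ m + d (e - 𝔼[Z]) / D(Z)` (`aggregator_le`). So `U` is finite, and the
ratios `D(Z) / (ess-sup Z - 𝔼[Z])` are bounded, since otherwise `V m d = m`; this is range normalization
after scaling. If `U` is cash additive as well, then `V m d = g d + m`, and comparing `a Z` with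
`a' Z` for `a' > a` shows in the same way that `g` is Lipschitz, with the inverse of the supremum of
the ratios as constant.

Conversely, range normalization of `λ D` means that `ρ = 𝔼 + λ D` is monotone, that is, a finite
law-invariant coherent risk measure, and the Lipschitz bound on `g` transfers monotonicity and
SSD-consistency from `ρ` to `g(D) + 𝔼`. What remains is that `ρ` is SSD-consistent
(`IsLawInvariantCoherent.le_of_stopLoss`), which rests on three facts.

* Averaging does not increase `ρ` (`IsLawInvariantCoherent.average_le`): if `Z` takes two values on
  a set, exchanging them on two parts of equal probability preserves the law, so by convexity the
  mean of the two versions has no larger `ρ`; iterating this flattens `Z` uniformly. Parts of the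
  required size exist by Sierpiński's theorem (`IsNonatomic.exists_subset_eq`). The argument uses
  no continuity beyond the uniform norm, so it covers `p = ∞`.
* Two simple random variables can be rearranged to be increasing functions on one finite ordered
  partition (`IsNonatomic.exists_comonotone`), where the stop-loss order becomes weak majorization
  with weights; as in the theorem of Hardy, Littlewood and Pólya, the larger vector is brought above
  the smaller one by finitely many transfers (`le_of_weak_majorization`), each of which is a partial
  averaging.
* A finite coherent risk measure on `L^p` is norm continuous
  (`IsLawInvariantCoherent.exists_le_norm`), which reduces the general case to simple random
  variables.
-/

noncomputable section

namespace MeanDeviation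

/-! ### Subsets of prescribed probability -/

section Sierpinski

variable {Ω : Type*} [MeasurableSpace Ω] {P : Measure Ω} [IsProbabilityMeasure P]

lemma IsNonatomic.exists_subset_le_half (hP : IsNonatomic P) {A : Set Ω} (hA : MeasurableSet A)
    (h : 0 < P A) : ∃ B ⊆ A, MeasurableSet B ∧ 0 < P B ∧ P B ≤ P A / 2 := by
  obtain ⟨B, hBA, hB, hB0, hBlt⟩ := hP A hA h
  have hsum : P B + P (A \ B) = P A := by
    rw [← measure_union Set.disjoint_sdiff_right (hA.diff hB), Set.union_sdiff_cancel hBA]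
  rcases le_or_gt (P B) (P A / 2) with h1 | h1
  · exact ⟨B, hBA, hB, hB0, h1⟩
  · refine ⟨A \ B, Set.sdiff_subset, hA.diff hB, ?_, ?_⟩
    · rw [measure_sdiff hBA hB.nullMeasurableSet (measure_ne_top _ _)]
      exact tsub_pos_of_lt hBlt
    · by_contra! h2
      have := ENNReal.add_lt_add h1 h2
      rw [ENNReal.add_halves, hsum] at this
      exact lt_irrefl _ this

lemma IsNonatomic.exists_subset_lt (hP : IsNonatomic P) {A : Set Ω} (hA : MeasurableSet A)
    (h : 0 < P A) {ε : ℝ≥0∞} (hε : 0 < ε) :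
    ∃ B ⊆ A, MeasurableSet B ∧ 0 < P B ∧ P B < ε := by
  have key : ∀ n : ℕ, ∃ B ⊆ A, MeasurableSet B ∧ 0 < P B ∧ P B ≤ 2⁻¹ ^ n := by
    intro n
    induction n with
    | zero => exact ⟨A, subset_rfl, hA, h, by simpa using prob_le_one⟩
    | succ n ih =>
      obtain ⟨B, hBA, hB, hB0, hBn⟩ := ih
      obtain ⟨C, hCB, hC, hC0, hCn⟩ := hP.exists_subset_le_half hB hB0
      refine ⟨C, hCB.trans hBA, hC, hC0, hCn.trans ?_⟩
      rw [pow_succ, div_eq_mul_inv]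
      gcongr
  obtain ⟨n, hn⟩ := ENNReal.exists_inv_two_pow_lt hε.ne'
  obtain ⟨B, h1, h2, h3, h4⟩ := key n
  exact ⟨B, h1, h2, h3, h4.trans_lt hn⟩

/-- **Sierpiński's theorem**: a nonatomic probability measure takes every value between `0` and
`P A` on the measurable subsets of `A`. -/
theorem IsNonatomic.exists_subset_eq (hP : IsNonatomic P) {A : Set Ω} (hA : MeasurableSet A)
    {β : ℝ≥0∞} (hβ : β ≤ P A) : ∃ B ⊆ A, MeasurableSet B ∧ P B = β := by
  -- `s B` is the supremum of the measures by which `B` can be extended without exceeding `β`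
  let T (B : Set Ω) : Set (Set Ω) := {C | C ⊆ A \ B ∧ MeasurableSet C ∧ P B + P C ≤ β}
  let s (B : Set Ω) : ℝ≥0∞ := ⨆ C ∈ T B, P C
  have hstep : ∀ B : {B : Set Ω // B ⊆ A ∧ MeasurableSet B ∧ P B ≤ β},
      ∃ C ∈ T B.1, s B.1 / 2 ≤ P C := by
    intro ⟨B, hBA, hB, hBβ⟩
    rcases eq_or_ne (s B) 0 with h0 | h0
    · exact ⟨∅, ⟨by simp, .empty, by simpa using hBβ⟩, by simp [h0]⟩
    · have hs : s B ≤ 1 := iSup₂_le fun C _ => prob_le_one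
      have : s B / 2 < s B := ENNReal.half_lt_self h0 (ne_top_of_le_ne_top ENNReal.one_ne_top hs)
      obtain ⟨C, hC⟩ := lt_iSup_iff.1 this
      obtain ⟨hCT, hC⟩ := lt_iSup_iff.1 hC
      exact ⟨C, hCT, hC.le⟩
  choose C hCT hC using hstep
  let next (B : {B : Set Ω // B ⊆ A ∧ MeasurableSet B ∧ P B ≤ β}) :
      {B : Set Ω // B ⊆ A ∧ MeasurableSet B ∧ P B ≤ β} :=
    ⟨B.1 ∪ C B, Set.union_subset B.2.1 ((hCT B).1.trans Set.sdiff_subset),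
      B.2.2.1.union (hCT B).2.1, (measure_union_le _ _).trans (hCT B).2.2⟩
  let B (n : ℕ) := next^[n] ⟨∅, by simp, .empty, by simp⟩
  have hBs (n : ℕ) : B (n + 1) = next (B n) := Function.iterate_succ_apply' _ _ _
  have hmono : Monotone fun n => (B n).1 := by
    refine monotone_nat_of_le_succ fun n => ?_
    simp only [hBs]
    exact Set.subset_union_left
  let L := ⋃ n, (B n).1
  have hL : MeasurableSet L := .iUnion fun n => (B n).2.2.1
  have hLA : L ⊆ A := Set.iUnion_subset fun n => (B n).2.1
  have hLβ : P L ≤ β := by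
    rw [hmono.measure_iUnion]
    exact iSup_le fun n => (B n).2.2.2
  refine ⟨L, hLA, hL, hLβ.antisymm ?_⟩
  by_contra! hlt
  have hpos : 0 < P (A \ L) := by
    rw [measure_sdiff hLA hL.nullMeasurableSet (measure_ne_top _ _)]
    exact tsub_pos_of_lt (hlt.trans_le hβ)
  obtain ⟨E, hEA, hE, hE0, hElt⟩ :=
    hP.exists_subset_lt (hA.diff hL) hpos (tsub_pos_of_lt hlt)
  -- `E` could be added at every stage, so every stage adds at least `P E / 2`
  have hadd (n : ℕ) : P E / 2 ≤ P (C (B n)) := by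
    refine le_trans ?_ (hC (B n))
    gcongr
    refine le_iSup₂_of_le (f := fun D (_ : D ∈ T (B n).1) => P D) E ⟨hEA.trans ?_, hE, ?_⟩ le_rfl
    · exact Set.sdiff_subset_sdiff_right (Set.subset_iUnion (fun n => (B n).1) n)
    · calc P (B n).1 + P E ≤ P L + (β - P L) :=
            add_le_add (measure_mono (Set.subset_iUnion (fun n => (B n).1) n)) hElt.le
        _ = β := add_tsub_cancel_of_le hLβ
  have hgrow (n : ℕ) : n * (P E / 2) ≤ P (B n).1 := by
    induction n with
    | zero => simp
    | succ n ih =>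
      have : P (B (n + 1)).1 = P (B n).1 + P (C (B n)) := by
        rw [hBs]
        exact measure_union (Set.disjoint_sdiff_right.mono_right (hCT (B n)).1) (hCT (B n)).2.1
      rw [this, Nat.cast_succ, add_mul, one_mul]
      exact add_le_add ih (hadd n)
  obtain ⟨n, hn⟩ := ENNReal.exists_nat_mul_gt (a := P E / 2) (b := 1)
    (ENNReal.half_pos hE0.ne').ne' ENNReal.one_ne_top
  exact absurd ((hgrow n).trans prob_le_one) (not_le.2 hn)

end Sierpinski

/-! ### Weak majorization -/

section Majorization

variable {ι : Type*} [Fintype ι] [LinearOrder ι]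

/-- Weighted form of the theorem of Hardy, Littlewood and Pólya: if a nondecreasing vector `x` is
weakly majorized by `z` (comparison of the weighted tail sums), then `φ x ≤ φ z` for every
increasing `φ` that decreases under order-preserving transfers from a larger to a smaller
entry. -/
theorem le_of_weak_majorization {p : ι → ℝ} (hp : ∀ i, 0 < p i) {φ : (ι → ℝ) → ℝ}
    (hmono : Monotone φ)
    (htrans : ∀ (z : ι → ℝ) (j k : ι) (δ : ℝ), j ≠ k → 0 ≤ δ → z j + δ / p j ≤ z k - δ / p k →
      φ (Function.update (Function.update z j (z j + δ / p j)) k (z k - δ / p k)) ≤ φ z)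
    {x : ι → ℝ} (hx : Monotone x) (z : ι → ℝ)
    (hz : ∀ k, 0 ≤ ∑ i with k ≤ i, p i * (z i - x i)) : φ x ≤ φ z := by
  induction hn : (Finset.univ.filter fun i => z i ≠ x i).card using Nat.strong_induction_on
    generalizing z with
  | _ n ih =>
  by_cases hle : ∀ i, x i ≤ z i
  · exact hmono hle
  push Not at hle
  -- `j` is the last entry of `z` that is too small, `k` the first one after it that is too large
  obtain ⟨j, hj, hjmax⟩ := (Finset.univ.filter fun i => z i < x i).exists_max_image id
    (by obtain ⟨i, hi⟩ := hle; exact ⟨i, by simpa using hi⟩)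
  simp only [Finset.mem_filter, Finset.mem_univ, true_and, id] at hj hjmax
  have hafter : ∀ i, j < i → x i ≤ z i := fun i hi => by
    by_contra! h
    exact absurd (hjmax i h) (not_le.2 hi)
  have hex : ∃ k, j < k ∧ x k < z k := by
    by_contra! h
    have h1 : ∑ i with j ≤ i, p i * (z i - x i) = p j * (z j - x j) := by
      rw [Finset.sum_eq_single_of_mem j (by simp)]
      intro i hi hij
      have hji : j < i := lt_of_le_of_ne (by simpa using hi) (Ne.symm hij)
      rw [le_antisymm (h i hji) (hafter i hji), sub_self, mul_zero]
    have := hz j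
    rw [h1] at this
    nlinarith [hp j]
  obtain ⟨k, hk, hkmin⟩ := (Finset.univ.filter fun i => j < i ∧ x i < z i).exists_min_image id
    (by obtain ⟨i, hi⟩ := hex; exact ⟨i, by simpa using hi⟩)
  simp only [Finset.mem_filter, Finset.mem_univ, true_and, id] at hk hkmin
  obtain ⟨hjk, hk⟩ := hk
  have hbetween : ∀ i, j < i → i < k → z i = x i := fun i h1 h2 =>
    le_antisymm (by by_contra! h; exact absurd (hkmin i ⟨h1, h⟩) (not_le.2 h2)) (hafter i h1)
  set δ := min (p j * (x j - z j)) (p k * (z k - x k)) with hδ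
  have hδ0 : 0 < δ := lt_min (mul_pos (hp j) (sub_pos.2 hj)) (mul_pos (hp k) (sub_pos.2 hk))
  have hδj : z j + δ / p j ≤ x j := by
    have : δ / p j ≤ x j - z j := by
      rw [div_le_iff₀ (hp j), mul_comm]; exact min_le_left _ _
    linarith
  have hδk : x k ≤ z k - δ / p k := by
    have : δ / p k ≤ z k - x k := by
      rw [div_le_iff₀ (hp k), mul_comm]; exact min_le_right _ _
    linarith
  set w := Function.update (Function.update z j (z j + δ / p j)) k (z k - δ / p k) with hw
  have hwj : w j = z j + δ / p j := by simp [hw, hjk.ne]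
  have hwk : w k = z k - δ / p k := by simp [hw]
  have hwi : ∀ i, i ≠ j → i ≠ k → w i = z i := fun i h1 h2 => by simp [hw, h1, h2]
  have hwz : φ w ≤ φ z :=
    htrans z j k δ hjk.ne hδ0.le (hδj.trans ((hx hjk.le).trans hδk))
  refine le_trans (ih _ ?_ w ?_ rfl) hwz
  · rw [← hn]
    apply Finset.card_lt_card
    refine Finset.ssubset_iff_subset_ne.2 ⟨fun i hi => ?_, fun heq => ?_⟩
    · simp only [Finset.mem_filter, Finset.mem_univ, true_and] at hi ⊢
      by_cases h1 : i = j
      · subst h1; exact hj.ne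
      by_cases h2 : i = k
      · subst h2; exact hk.ne'
      rwa [← hwi i h1 h2]
    · have hjm : w j ≠ x j := by
        have : j ∈ Finset.univ.filter fun i => z i ≠ x i := by simpa using hj.ne
        rw [← heq] at this
        simpa using this
      have hkm : w k ≠ x k := by
        have : k ∈ Finset.univ.filter fun i => z i ≠ x i := by simpa using hk.ne'
        rw [← heq] at this
        simpa using this
      rw [hwj] at hjm
      rw [hwk] at hkm
      rcases min_choice (p j * (x j - z j)) (p k * (z k - x k)) with h | h
      · apply hjm
        rw [hδ, h, mul_div_cancel_left₀ _ (hp j).ne']; ring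
      · apply hkm
        rw [hδ, h, mul_div_cancel_left₀ _ (hp k).ne']; ring
  · intro l
    have hdiff : ∀ i, p i * (w i - x i) =
        p i * (z i - x i) + ((if i = j then δ else 0) - (if i = k then δ else 0)) := by
      intro i
      by_cases h1 : i = j
      · subst h1
        rw [hwj, if_pos rfl, if_neg hjk.ne]
        field_simp [(hp i).ne']; ring
      by_cases h2 : i = k
      · subst h2
        rw [hwk, if_neg h1, if_pos rfl]
        field_simp [(hp i).ne']; ring
      rw [hwi i h1 h2, if_neg h1, if_neg h2]; ring
    simp only [hdiff, Finset.sum_add_distrib, Finset.sum_sub_distrib, Finset.sum_ite_eq',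
      Finset.mem_filter, Finset.mem_univ, true_and]
    by_cases hlj : l ≤ j
    · simpa [hlj, hlj.trans hjk.le] using hz l
    by_cases hlk : l ≤ k
    · -- between `j` and `k` the tail sums of `z - x` exceed the one at `j` by `p j * (x j - z j)`
      push Not at hlj
      have h1 : ∑ i with l ≤ i, p i * (z i - x i) =
          ∑ i with j ≤ i, p i * (z i - x i) - p j * (z j - x j) := by
        rw [← Finset.sum_erase_eq_sub (by simp)]
        refine Finset.sum_subset (fun i hi => ?_) (fun i hi hi' => ?_)
        · have : l ≤ i := by simpa using hi
          simpa using ⟨(hlj.trans_le this).ne', (hlj.trans_le this).le⟩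
        · have h2 : i ≠ j ∧ j ≤ i := by simpa using hi
          have h3 : i < l := by simpa using hi'
          rw [hbetween i (lt_of_le_of_ne h2.2 h2.1.symm) (h3.trans_le hlk), sub_self, mul_zero]
      have h2 : δ ≤ p j * (x j - z j) := min_le_left _ _
      have h3 := hz j
      simp only [not_le.2 hlj, if_false, hlk, if_true]
      rw [h1]
      linarith
    · simpa [hlj, hlk] using hz l

end Majorization

/-! ### Law-invariant coherent functionals -/

section Coherent

variable {Ω : Type*} [MeasurableSpace Ω] {P : Measure Ω} [IsProbabilityMeasure P] {p : ℝ≥0∞}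
  {r : (Ω → ℝ) → ℝ}

/-- Finite law-invariant coherent risk measures on `L^p`, written as functionals of genuine
functions: only the values at functions with `MemLp` matter, and `mono` makes them depend on the
almost sure class only. -/
structure IsLawInvariantCoherent (P : Measure Ω) (p : ℝ≥0∞) (r : (Ω → ℝ) → ℝ) : Prop where
  mono : ∀ {f g : Ω → ℝ}, MemLp f p P → MemLp g p P → f ≤ᵐ[P] g → r f ≤ r g
  add_const : ∀ {f : Ω → ℝ} (c : ℝ), MemLp f p P → r (fun ω => f ω + c) = r f + c
  smul : ∀ {f : Ω → ℝ} {a : ℝ}, 0 ≤ a → MemLp f p P → r (fun ω => a * f ω) = a * r f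
  add_le : ∀ {f g : Ω → ℝ}, MemLp f p P → MemLp g p P → r (fun ω => f ω + g ω) ≤ r f + r g
  law_invariant : ∀ {f g : Ω → ℝ}, MemLp f p P → MemLp g p P → IdentDistrib f g P P → r f = r g

open Classical in
/-- The function that takes the value `b` on `B` and agrees with `f` elsewhere. -/
def overwrite (B : Set Ω) (b : ℝ) (f : Ω → ℝ) (ω : Ω) : ℝ := if ω ∈ B then b else f ω

omit [MeasurableSpace Ω] in
@[simp] lemma overwrite_of_mem {B : Set Ω} {ω : Ω} (h : ω ∈ B) (b : ℝ) (f : Ω → ℝ) :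
    overwrite B b f ω = b := if_pos h

omit [MeasurableSpace Ω] in
@[simp] lemma overwrite_of_notMem {B : Set Ω} {ω : Ω} (h : ω ∉ B) (b : ℝ) (f : Ω → ℝ) :
    overwrite B b f ω = f ω := if_neg h

open Classical in
lemma memLp_overwrite {B : Set Ω} (hB : MeasurableSet B) (b : ℝ) {f : Ω → ℝ}
    (hf : MemLp f p P) : MemLp (overwrite B b f) p P :=
  MemLp.piecewise hB ((memLp_const b).restrict _) (hf.restrict _)

/-- Exchanging the values `b` and `c` of a function on two sets of equal probability does not change
its law. -/
lemma identDistrib_swap {B C : Set Ω} (hB : MeasurableSet B) (hC : MeasurableSet C)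
    (hBC : Disjoint B C) (heq : P B = P C) {Z : Ω → ℝ} (hZ : MemLp Z p P) (b c : ℝ) :
    IdentDistrib (overwrite B b (overwrite C c Z))
      (overwrite B c (overwrite C b Z)) P P := by
  have hm (b c : ℝ) : AEMeasurable (overwrite B b (overwrite C c Z)) P :=
    (memLp_overwrite hB b
      (memLp_overwrite hC c hZ)).aestronglyMeasurable.aemeasurable
  refine ⟨hm b c, hm c b, ?_⟩
  ext S hS
  have key (b c : ℝ) : P.map (overwrite B b (overwrite C c Z)) S =
      P {ω | ω ∈ B ∧ b ∈ S} + (P {ω | ω ∈ C ∧ c ∈ S} + P ((Z ⁻¹' S \ B) \ C)) := by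
    rw [Measure.map_apply_of_aemeasurable (hm b c) hS, ← measure_inter_add_sdiff _ hB]
    congr 1
    · congr 1
      ext ω
      simp only [Set.mem_inter_iff, Set.mem_preimage, Set.mem_ofPred_eq]
      by_cases h : ω ∈ B <;> simp [h]
    · rw [← measure_inter_add_sdiff _ hC]
      congr 2
      · ext ω
        have : ω ∈ C → ω ∉ B := fun h => Set.disjoint_right.1 hBC h
        simp only [Set.mem_inter_iff, Set.mem_sdiff, Set.mem_preimage, Set.mem_ofPred_eq]
        by_cases h : ω ∈ C
        · simp [h, this h]
        · simp [h]
      · ext ω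
        simp only [Set.mem_sdiff, Set.mem_preimage]
        by_cases h : ω ∈ B <;> by_cases h' : ω ∈ C <;> simp [h, h']
  rw [key, key]
  by_cases h1 : b ∈ S <;> by_cases h2 : c ∈ S <;> simp [h1, h2, heq]

namespace IsLawInvariantCoherent

omit [IsProbabilityMeasure P] in
lemma congr (hr : IsLawInvariantCoherent P p r) {f g : Ω → ℝ} (hf : MemLp f p P)
    (hg : MemLp g p P) (h : f =ᵐ[P] g) : r f = r g :=
  (hr.mono hf hg h.le).antisymm (hr.mono hg hf h.symm.le)

/-- Automatic continuity: a finite coherent functional is bounded by a multiple of the norm, since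
otherwise it would be infinite at the sum of a suitable series of nonnegative functions. -/
theorem exists_le_norm [Fact (1 ≤ p)] (hr : IsLawInvariantCoherent P p r) :
    ∃ C : ℝ, 0 ≤ C ∧ ∀ f : Ω → ℝ, MemLp f p P → 0 ≤ᵐ[P] f →
      r f ≤ C * (eLpNorm f p P).toReal := by
  by_contra! H
  have H' (n : ℕ) : ∃ F : Lp ℝ p P, 0 ≤ F ∧ ‖F‖ = (1 / 2) ^ n ∧ (2 : ℝ) ^ n ≤ r F := by
    obtain ⟨f, hf, hf0, hlt⟩ := H ((4 : ℝ) ^ n) (by positivity)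
    have hnorm : ‖hf.toLp f‖ = (eLpNorm f p P).toReal := Lp.norm_toLp f hf
    rw [← hnorm] at hlt
    have hpos : 0 < ‖hf.toLp f‖ := by
      refine lt_of_le_of_ne (norm_nonneg _) fun h0 => ?_
      have hz : f =ᵐ[P] fun _ => 0 := by
        exact hf.coeFn_toLp.symm.trans ((Lp.eq_zero_iff_ae_eq_zero).1 (norm_eq_zero.1 h0.symm))
      have h1 := hr.congr hf (memLp_const 0) hz
      have h2 := hr.smul (a := 0) le_rfl hf
      simp only [zero_mul] at h2
      rw [← h0, h1, h2, mul_zero] at hlt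
      exact lt_irrefl _ hlt
    set a : ℝ := (1 / 2) ^ n / ‖hf.toLp f‖ with ha
    have ha0 : 0 < a := by positivity
    have hco : (a • hf.toLp f : Lp ℝ p P) =ᵐ[P] fun ω => a * f ω := by
      filter_upwards [Lp.coeFn_smul a (hf.toLp f), hf.coeFn_toLp] with ω h1 h2
      rw [h1, Pi.smul_apply, h2, smul_eq_mul]
    refine ⟨a • hf.toLp f, ?_, ?_, ?_⟩
    · rw [← Lp.coeFn_nonneg]
      filter_upwards [hco, hf0] with ω h1 h2
      rw [h1]
      exact mul_nonneg ha0.le h2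
    · rw [norm_smul, Real.norm_of_nonneg ha0.le, ha, div_mul_cancel₀ _ hpos.ne']
    · rw [hr.congr (Lp.memLp _) (hf.const_mul a) hco, hr.smul ha0.le hf]
      calc (2 : ℝ) ^ n = a * (4 ^ n * ‖hf.toLp f‖) := by
            rw [ha]
            field_simp
            rw [← mul_pow]; norm_num
        _ ≤ a * r f := by gcongr
  choose F hF0 hF hrF using H'
  have hs : Summable F := Summable.of_norm (by simpa [hF] using summable_geometric_two)
  obtain ⟨n, hn⟩ := pow_unbounded_of_one_lt (r (∑' n, F n : Lp ℝ p P)) (one_lt_two (α := ℝ))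
  have hle : F n ≤ ∑' n, F n := hs.le_tsum n fun i _ => hF0 i
  have := hr.mono (Lp.memLp _) (Lp.memLp _) ((Lp.coeFn_le _ _).2 hle)
  linarith [hrF n]

omit [IsProbabilityMeasure P] in
lemma le_add (hr : IsLawInvariantCoherent P p r) {f g h : Ω → ℝ} (hf : MemLp f p P)
    (hg : MemLp g p P) (hh : MemLp h p P) (hle : ∀ᵐ ω ∂P, f ω ≤ g ω + h ω) :
    r f ≤ r g + r h :=
  (hr.mono hf (hg.add hh) hle).trans (hr.add_le hg hh)

/-- The bound of `average_le` up to an error that is halved by each of `n` swaps. -/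
lemma average_aux (hP : IsNonatomic P) (hr : IsLawInvariantCoherent P p r) {E : Set Ω}
    (hE : MeasurableSet E) (hE0 : 0 < P.real E) {Z : Ω → ℝ} (hZ : MemLp Z p P) {m : ℝ} (n : ℕ) :
    ∀ {B : Set Ω} {b c : ℝ}, B ⊆ E → MeasurableSet B →
      m * P.real E = b * P.real B + c * P.real (E \ B) →
      r (overwrite E m Z) ≤
        r (overwrite B b (overwrite E c Z)) + |b - c| / 2 ^ n := by
  have hmem {B : Set Ω} (hB : MeasurableSet B) (b c : ℝ) :
      MemLp (overwrite B b (overwrite E c Z)) p P :=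
    memLp_overwrite hB b (memLp_overwrite hE c hZ)
  have hsub {B : Set Ω} (hBE : B ⊆ E) (hB : MeasurableSet B) :
      P.real (E \ B) = P.real E - P.real B := measureReal_sdiff hBE hB
  induction n with
  | zero =>
    intro B b c hBE hB hm
    rw [pow_zero, div_one, ← hr.add_const _ (hmem hB b c)]
    refine hr.mono (memLp_overwrite hE m hZ)
      ((hmem hB b c).add (memLp_const _)) (.of_forall fun ω => ?_)
    rw [hsub hBE hB] at hm
    have hB0 : 0 ≤ P.real B := measureReal_nonneg
    have hBE' : P.real B ≤ P.real E := measureReal_mono hBE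
    have h1 : m ≤ b + |b - c| := by
      have : (m - b) * P.real E ≤ |b - c| * P.real E := by
        nlinarith [neg_abs_le (b - c), le_abs_self (b - c), abs_nonneg (b - c)]
      linarith [le_of_mul_le_mul_right this hE0]
    have h2 : m ≤ c + |b - c| := by
      have : (m - c) * P.real E ≤ |b - c| * P.real E := by
        nlinarith [neg_abs_le (b - c), le_abs_self (b - c), abs_nonneg (b - c)]
      linarith [le_of_mul_le_mul_right this hE0]
    by_cases hωB : ω ∈ B
    · simpa [hωB, hBE hωB] using h1
    by_cases hωE : ω ∈ E
    · simpa [hωB, hωE] using h2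
    · simp [hωB, hωE]
  | succ n ih =>
    have key {B : Set Ω} {b c : ℝ} (hBE : B ⊆ E) (hB : MeasurableSet B)
        (hm : m * P.real E = b * P.real B + c * P.real (E \ B)) (hle : P B ≤ P (E \ B)) :
        r (overwrite E m Z) ≤
          r (overwrite B b (overwrite E c Z)) + |b - c| / 2 ^ (n + 1) := by
      obtain ⟨C, hCE, hC, hPC⟩ := hP.exists_subset_eq (hE.diff hB) hle
      have hBC : Disjoint B C := Set.disjoint_sdiff_right.mono_right hCE
      have hCE' : C ⊆ E := hCE.trans Set.sdiff_subset
      have hPU : P.real (B ∪ C) = 2 * P.real B := by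
        rw [measureReal_union hBC hC, measureReal_def, measureReal_def, hPC]; ring
      have h1 := ih (B := B ∪ C) (b := (b + c) / 2) (c := c) (Set.union_subset hBE hCE')
        (hB.union hC) (by
          rw [hsub (Set.union_subset hBE hCE') (hB.union hC), hPU, hm, hsub hBE hB]; ring)
      have h2 : |(b + c) / 2 - c| / 2 ^ n = |b - c| / 2 ^ (n + 1) := by
        rw [show (b + c) / 2 - c = (b - c) / 2 by ring, abs_div, abs_two, pow_succ, div_div,
          mul_comm 2]
      rw [h2] at h1
      refine h1.trans (add_le_add ?_ le_rfl)
      have hZc : MemLp (overwrite E c Z) p P := memLp_overwrite hE c hZ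
      set W₁ := overwrite B b (overwrite C c (overwrite E c Z))
      set W₂ := overwrite B c (overwrite C b (overwrite E c Z))
      have hW₁ : MemLp W₁ p P := memLp_overwrite hB b
        (memLp_overwrite hC c hZc)
      have hW₂ : MemLp W₂ p P := memLp_overwrite hB c
        (memLp_overwrite hC b hZc)
      have hlaw : r W₁ = r W₂ :=
        hr.law_invariant hW₁ hW₂ (identDistrib_swap hB hC hBC hPC.symm hZc b c)
      have hW : overwrite B b (overwrite E c Z) = W₁ := by
        ext ω
        by_cases hωB : ω ∈ B
        · simp [W₁, hωB]
        by_cases hωC : ω ∈ C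
        · simp [W₁, hωB, hωC, hCE' hωC]
        · simp [W₁, hωB, hωC]
      have havg : overwrite (B ∪ C) ((b + c) / 2) (overwrite E c Z) =
          fun ω => 1 / 2 * W₁ ω + 1 / 2 * W₂ ω := by
        ext ω
        by_cases hωB : ω ∈ B
        · simp [W₁, W₂, hωB]; ring
        by_cases hωC : ω ∈ C
        · simp [W₁, W₂, hωB, hωC]; ring
        · simp [W₁, W₂, hωB, hωC]; ring
      rw [hW, havg]
      refine (hr.add_le (hW₁.const_mul _) (hW₂.const_mul _)).trans ?_
      rw [hr.smul (by norm_num) hW₁, hr.smul (by norm_num) hW₂, ← hlaw]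
      linarith
    intro B b c hBE hB hm
    rcases le_total (P B) (P (E \ B)) with h | h
    · exact key hBE hB hm h
    · have hBB : E \ (E \ B) = B := Set.sdiff_sdiff_cancel_left hBE
      have hW : overwrite B b (overwrite E c Z) =
          overwrite (E \ B) c (overwrite E b Z) := by
        ext ω
        by_cases hωB : ω ∈ B
        · simp [hωB, hBE hωB]
        by_cases hωE : ω ∈ E <;> simp [hωB, hωE]
      rw [hW, abs_sub_comm]
      exact key (b := c) (c := b) Set.sdiff_subset (hE.diff hB) (by rw [hBB, hm]; ring)
        (by rwa [hBB])

/-- If `Z` takes the value `b` on `B` and `c` on `E \ B`, replacing it on `E` by its average `m`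
does not increase `r`. Swapping the value on the smaller of the two sets with the value on an
equally likely part of the larger one preserves the law, and averaging the two versions halves the
oscillation on `E`; this is iterated. -/
theorem average_le (hP : IsNonatomic P) (hr : IsLawInvariantCoherent P p r) {E : Set Ω}
    (hE : MeasurableSet E) (hE0 : 0 < P.real E) {Z : Ω → ℝ} (hZ : MemLp Z p P) {m b c : ℝ}
    {B : Set Ω} (hBE : B ⊆ E) (hB : MeasurableSet B)
    (hm : m * P.real E = b * P.real B + c * P.real (E \ B)) :
    r (overwrite E m Z) ≤ r (overwrite B b (overwrite E c Z)) := by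
  have hlim : Filter.Tendsto (fun n : ℕ => r (overwrite B b
      (overwrite E c Z)) + |b - c| * (1 / 2) ^ n) Filter.atTop
      (nhds (r (overwrite B b (overwrite E c Z)) + |b - c| * 0)) :=
    ((tendsto_pow_atTop_nhds_zero_of_lt_one (by norm_num) (by norm_num)).const_mul _).const_add _
  rw [mul_zero, add_zero] at hlim
  refine ge_of_tendsto' hlim fun n => ?_
  have := average_aux hP hr hE hE0 hZ n hBE hB hm
  rwa [div_eq_mul_inv, ← inv_pow, ← one_div] at this

end IsLawInvariantCoherent

end Coherent

/-! ### Step functions -/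

section StepFunctions

variable {Ω : Type*} [MeasurableSpace Ω] {P : Measure Ω} [IsProbabilityMeasure P] {p : ℝ≥0∞}
  {r : (Ω → ℝ) → ℝ} {ι : Type*} [Fintype ι] [MeasurableSpace ι] [MeasurableSingletonClass ι]

lemma memLp_comp_of_finite {f : Ω → ι} (hf : Measurable f) (z : ι → ℝ) :
    MemLp (fun ω => z (f ω)) p P :=
  MemLp.of_bound ((measurable_of_finite z).comp hf).aestronglyMeasurable (∑ i, ‖z i‖)
    (.of_forall fun _ => Finset.single_le_sum (f := fun i => ‖z i‖)
      (fun _ _ => norm_nonneg _) (Finset.mem_univ _))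

namespace IsLawInvariantCoherent

/-- A transfer between two blocks that keeps the order of their values does not increase `r`: it is
a convex combination of the identity and averaging over the two blocks. -/
lemma transfer_le (hP : IsNonatomic P) (hr : IsLawInvariantCoherent P p r) [DecidableEq ι]
    {f : Ω → ι} (hf : Measurable f) (hpos : ∀ i, 0 < P.real (f ⁻¹' {i})) (z : ι → ℝ) {j k : ι}
    {δ : ℝ} (hjk : j ≠ k) (hδ : 0 ≤ δ)
    (hle : z j + δ / P.real (f ⁻¹' {j}) ≤ z k - δ / P.real (f ⁻¹' {k})) :
    r (fun ω => Function.update (Function.update z j (z j + δ / P.real (f ⁻¹' {j}))) k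
      (z k - δ / P.real (f ⁻¹' {k})) (f ω)) ≤ r (fun ω => z (f ω)) := by
  rcases hδ.eq_or_lt with rfl | hδ
  · simp
  set a := P.real (f ⁻¹' {j})
  set b := P.real (f ⁻¹' {k})
  have ha : 0 < a := hpos j
  have hb : 0 < b := hpos k
  have hz := memLp_comp_of_finite (P := P) (p := p) hf z
  have hB : MeasurableSet (f ⁻¹' {j}) := hf (measurableSet_singleton j)
  have hE : MeasurableSet (f ⁻¹' {j, k}) := hf (Set.toFinite _).measurableSet
  have hdiff : f ⁻¹' {j, k} \ f ⁻¹' {j} = f ⁻¹' {k} := by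
    ext ω
    simp only [Set.mem_sdiff, Set.mem_preimage, Set.mem_insert_iff, Set.mem_singleton_iff]
    constructor
    · tauto
    · rintro h
      exact ⟨Or.inr h, fun h' => hjk (h'.symm.trans h)⟩
  have hPE : P.real (f ⁻¹' {j, k}) = a + b := by
    have := measureReal_sdiff (μ := P) (s₁ := f ⁻¹' {j, k}) (s₂ := f ⁻¹' {j})
      (Set.preimage_mono (by simp)) hB
    rw [hdiff] at this
    linarith
  set m := (a * z j + b * z k) / (a + b) with hm
  have hgap : 0 < z k - z j := by
    have h1 : 0 < δ / a := by positivity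
    have h2 : 0 < δ / b := by positivity
    linarith
  -- the weight of the average in that convex combination
  set t := δ * (a + b) / (a * b * (z k - z j)) with ht
  have ht0 : 0 ≤ t := by positivity
  have ht1 : t ≤ 1 := by
    rw [ht, div_le_one (by positivity)]
    have : δ / a + δ / b ≤ z k - z j := by linarith
    rw [div_add_div _ _ ha.ne' hb.ne', div_le_iff₀ (by positivity)] at this
    linarith
  have havg : r (overwrite (f ⁻¹' {j, k}) m fun ω => z (f ω)) ≤ r (fun ω => z (f ω)) := by
    have h := average_le hP hr hE (by rw [hPE]; positivity) hz (m := m) (b := z j) (c := z k)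
      (B := f ⁻¹' {j}) (Set.preimage_mono (by simp)) hB
      (by rw [hPE, hdiff, hm, div_mul_cancel₀ _ (by positivity)]; ring)
    refine h.trans_eq (congrArg r ?_)
    ext ω
    by_cases h1 : f ω = j
    · simp [overwrite, h1]
    by_cases h2 : f ω = k <;> simp [overwrite, h1, h2, hjk.symm]
  have hW := memLp_overwrite (p := p) (P := P) hE m hz
  have hcomb : (fun ω => Function.update (Function.update z j (z j + δ / a)) k
      (z k - δ / b) (f ω)) =
      fun ω => (1 - t) * z (f ω) + t * overwrite (f ⁻¹' {j, k}) m (fun ω => z (f ω)) ω := by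
    ext ω
    by_cases h2 : f ω = k
    · simp only [overwrite, h2, Function.update_self, Set.mem_preimage, Set.mem_insert_iff,
        Set.mem_singleton_iff, or_true, if_true, ht, hm]
      field_simp
      ring
    by_cases h1 : f ω = j
    · simp only [overwrite, h1, ne_eq, hjk, not_false_eq_true, Function.update_of_ne,
        Function.update_self, Set.mem_preimage, Set.mem_insert_iff, true_or, if_true, ht, hm]
      field_simp
      ring
    · simp [overwrite, h1, h2]
      ring
  rw [hcomb]
  refine (hr.add_le (hz.const_mul _) (hW.const_mul _)).trans ?_
  rw [hr.smul (by linarith) hz, hr.smul ht0 hW]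
  nlinarith

/-- For comonotone step functions over a common partition, the stop-loss order `𝔼[(X - c)⁺] ≤
𝔼[(Y - c)⁺]` is a comparison of weighted tail sums: the sum starting at the block `k` is obtained
from `c = y k`. -/
theorem comp_le_comp_of_stopLoss [LinearOrder ι] (hP : IsNonatomic P)
    (hr : IsLawInvariantCoherent P p r) {f : Ω → ι} (hf : Measurable f)
    (hpos : ∀ i, 0 < P.real (f ⁻¹' {i})) {x y : ι → ℝ} (hx : Monotone x) (hy : Monotone y)
    (h : ∀ c : ℝ, ∫ ω, max (x (f ω) - c) 0 ∂P ≤ ∫ ω, max (y (f ω) - c) 0 ∂P) :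
    r (fun ω => x (f ω)) ≤ r (fun ω => y (f ω)) := by
  refine le_of_weak_majorization (p := fun i => P.real (f ⁻¹' {i}))
    (φ := fun z => r (fun ω => z (f ω))) hpos ?_ ?_ hx y ?_
  · intro z w hzw
    exact hr.mono (memLp_comp_of_finite hf z) (memLp_comp_of_finite hf w)
      (.of_forall fun ω => hzw (f ω))
  · intro z j k δ hjk hδ hle
    exact hr.transfer_le hP hf hpos z hjk hδ hle
  · intro k
    have hint (z : ι → ℝ) : ∫ ω, z (f ω) ∂P = ∑ i, P.real (f ⁻¹' {i}) * z i := by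
      rw [← integral_map hf.aemeasurable (measurable_of_finite z).aestronglyMeasurable,
        integral_fintype (Integrable.of_finite)]
      refine Finset.sum_congr rfl fun i _ => ?_
      rw [map_measureReal_apply hf (measurableSet_singleton i), smul_eq_mul]
    have hk := h (y k)
    rw [hint fun i => max (x i - y k) 0, hint fun i => max (y i - y k) 0] at hk
    have h1 : ∑ i with k ≤ i, P.real (f ⁻¹' {i}) * (x i - y k) ≤
        ∑ i, P.real (f ⁻¹' {i}) * max (x i - y k) 0 :=
      (Finset.sum_le_sum fun i _ => by gcongr; exact le_max_left _ _).trans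
        (Finset.sum_le_sum_of_subset_of_nonneg (Finset.filter_subset _ _)
          fun i _ _ => by positivity)
    have h2 : ∑ i, P.real (f ⁻¹' {i}) * max (y i - y k) 0 =
        ∑ i with k ≤ i, P.real (f ⁻¹' {i}) * (y i - y k) := by
      rw [Finset.sum_filter]
      refine Finset.sum_congr rfl fun i _ => ?_
      split_ifs with hi
      · rw [max_eq_left (sub_nonneg.2 (hy hi))]
      · rw [max_eq_right (sub_nonpos.2 (hy (not_le.1 hi).le)), mul_zero]
    have h3 : ∑ i with k ≤ i, P.real (f ⁻¹' {i}) * (y i - x i) =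
        ∑ i with k ≤ i, P.real (f ⁻¹' {i}) * (y i - y k) -
        ∑ i with k ≤ i, P.real (f ⁻¹' {i}) * (x i - y k) := by
      rw [← Finset.sum_sub_distrib]
      exact Finset.sum_congr rfl fun i _ => by ring
    rw [h3]
    linarith

end IsLawInvariantCoherent

end StepFunctions

/-! ### Comonotone rearrangement -/

section Quantile

/-- The left-continuous quantile function of `μ` on `(0, 1)`, set to `0` elsewhere. -/
def quantile (μ : Measure ℝ) : ℝ → ℝ :=
  (Set.Ioo (0 : ℝ) 1).indicator fun t => sInf {x | t ≤ cdf μ x}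

variable {μ : Measure ℝ}

lemma quantile_le_iff {t : ℝ} (ht : t ∈ Set.Ioo (0 : ℝ) 1) (x : ℝ) :
    quantile μ t ≤ x ↔ t ≤ cdf μ x := by
  rw [quantile, Set.indicator_of_mem ht]
  have hne : {x | t ≤ cdf μ x}.Nonempty :=
    (((tendsto_cdf_atTop μ).eventually (lt_mem_nhds ht.2)).exists).imp fun _ h => h.le
  have hbdd : BddBelow {x | t ≤ cdf μ x} := by
    obtain ⟨y, hy⟩ := ((tendsto_cdf_atBot μ).eventually (gt_mem_nhds ht.1)).exists
    refine ⟨y, fun x hx => ?_⟩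
    by_contra! hlt
    exact absurd (hx.trans ((monotone_cdf μ) hlt.le)) (not_le.2 hy)
  refine ⟨fun h => ?_, fun h => csInf_le hbdd h⟩
  have hcont : Filter.Tendsto (cdf μ) (nhdsWithin x (Set.Ioi x)) (nhds (cdf μ x)) :=
    ((cdf μ).right_continuous x).mono_left (nhdsWithin_mono _ Set.Ioi_subset_Ici_self)
  refine ge_of_tendsto hcont ?_
  filter_upwards [self_mem_nhdsWithin] with y hy
  obtain ⟨z, hz, hzy⟩ := exists_lt_of_csInf_lt hne (h.trans_lt hy)
  exact hz.trans (monotone_cdf μ hzy.le)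

lemma quantile_monotoneOn : MonotoneOn (quantile μ) (Set.Ioo 0 1) := fun _ hs _ ht hst =>
  (quantile_le_iff hs _).2 (hst.trans ((quantile_le_iff ht _).1 le_rfl))

lemma quantile_preimage_Iic_inter (x : ℝ) : quantile μ ⁻¹' Set.Iic x ∩ Set.Ioo 0 1 =
    Set.Iic (cdf μ x) ∩ Set.Ioo 0 1 := by
  ext t
  exact and_congr_left fun ht => quantile_le_iff ht x

lemma measurable_quantile : Measurable (quantile μ) := by
  refine measurable_of_Iic fun x => ?_
  rw [← Set.inter_union_compl (quantile μ ⁻¹' Set.Iic x) (Set.Ioo 0 1),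
    quantile_preimage_Iic_inter]
  refine (measurableSet_Iic.inter measurableSet_Ioo).union ?_
  have : quantile μ ⁻¹' Set.Iic x ∩ (Set.Ioo 0 1)ᶜ = {_t | 0 ≤ x} ∩ (Set.Ioo 0 1)ᶜ := by
    ext t
    refine and_congr_left fun ht => ?_
    simp [quantile, Set.indicator_of_notMem ht]
  rw [this]
  exact (MeasurableSet.const _).inter measurableSet_Ioo.compl

instance : IsProbabilityMeasure (volume.restrict (Set.Ioo (0 : ℝ) 1)) := ⟨by simp⟩

lemma map_quantile [IsProbabilityMeasure μ] :
    (volume.restrict (Set.Ioo (0 : ℝ) 1)).map (quantile μ) = μ := by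
  have : IsProbabilityMeasure ((volume.restrict (Set.Ioo (0 : ℝ) 1)).map (quantile μ)) :=
    Measure.isProbabilityMeasure_map measurable_quantile.aemeasurable
  refine Measure.ext_of_Iic _ _ fun x => ?_
  rw [Measure.map_apply measurable_quantile measurableSet_Iic,
    Measure.restrict_apply (measurable_quantile measurableSet_Iic), quantile_preimage_Iic_inter,
    ← ofReal_cdf μ x]
  have h : (Set.Iic (cdf μ x) ∩ Set.Ioo 0 1 : Set ℝ) =ᵐ[volume] (Set.Ioo 0 (cdf μ x) : Set ℝ) := by
    rcases (cdf_le_one μ x).eq_or_lt with h1 | h1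
    · exact .of_eq (by rw [h1, Set.inter_eq_right.2 fun t ht => ht.2.le])
    · have : Set.Iic (cdf μ x) ∩ Set.Ioo 0 1 = Set.Ioc 0 (cdf μ x) := by
        ext t
        simp only [Set.mem_inter_iff, Set.mem_Iic, Set.mem_Ioo, Set.mem_Ioc]
        exact ⟨fun h => ⟨h.2.1, h.1⟩, fun h => ⟨h.2, h.1, h.2.trans_lt h1⟩⟩
      rw [this]
      exact Ioo_ae_eq_Ioc.symm
  rw [measure_congr h, Real.volume_Ioo, sub_zero]

end Quantile

section Coupling

variable {Ω : Type*} [MeasurableSpace Ω] {P : Measure Ω} [IsProbabilityMeasure P]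

open Classical in
/-- On a nonatomic space every law on a finite type is the law of some random variable. -/
lemma IsNonatomic.exists_map_eq (hP : IsNonatomic P) {ι : Type*} [Finite ι] [MeasurableSpace ι]
    [MeasurableSingletonClass ι] (ν : Measure ι) [IsProbabilityMeasure ν] :
    ∃ f : Ω → ι, Measurable f ∧ P.map f = ν := by
  have key : ∀ s : Finset ι, s.Nonempty → ∀ A : Set Ω, MeasurableSet A → P A = ∑ i ∈ s, ν {i} →
      ∃ f : Ω → ι, Measurable f ∧ (∀ ω, f ω ∈ s) ∧ ∀ i ∈ s, P (A ∩ f ⁻¹' {i}) = ν {i} := by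
    intro s hs
    induction hs using Finset.Nonempty.cons_induction with
    | singleton a =>
      intro A hA hPA
      exact ⟨fun _ => a, measurable_const, by simp, by simpa using hPA⟩
    | cons a s ha hs ih =>
      intro A hA hPA
      rw [Finset.sum_cons] at hPA
      obtain ⟨B, hBA, hB, hPB⟩ := hP.exists_subset_eq hA (β := ν {a}) (hPA ▸ le_self_add)
      obtain ⟨f, hf, hfs, hPf⟩ := ih (A \ B) (hA.diff hB) (by
        rw [measure_sdiff hBA hB.nullMeasurableSet (measure_ne_top _ _), hPA, hPB]
        exact ENNReal.add_sub_cancel_left (measure_ne_top _ _))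
      refine ⟨fun ω => if ω ∈ B then a else f ω, Measurable.ite hB measurable_const hf, ?_, ?_⟩
      · intro ω
        by_cases hω : ω ∈ B <;> simp [hω, hfs]
      · intro i hi
        rcases Finset.mem_cons.1 hi with rfl | his
        · rw [← hPB]
          congr 1
          ext ω
          have h1 : f ω ≠ i := fun h => ha (h ▸ hfs ω)
          by_cases hω : ω ∈ B
          · simp [hω, hBA hω]
          · simp [hω, h1]
        · rw [← hPf i his]
          congr 1
          ext ω
          have h1 : a ≠ i := fun h => ha (h ▸ his)
          by_cases hω : ω ∈ B <;> simp [hω, h1]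
  have := Fintype.ofFinite ι
  have : Nonempty ι := nonempty_of_isProbabilityMeasure ν
  obtain ⟨f, hf, -, hPf⟩ := key Finset.univ Finset.univ_nonempty Set.univ .univ (by simp)
  refine ⟨f, hf, Measure.ext_of_singleton fun i => ?_⟩
  rw [Measure.map_apply hf (measurableSet_singleton i), ← hPf i (Finset.mem_univ i),
    Set.univ_inter]

/-- Two random variables with finitely many values can be rearranged, keeping their laws, to be
increasing functions of one random variable with values in a finite linear order. -/
theorem IsNonatomic.exists_comonotone (hP : IsNonatomic P) {X Y : Ω → ℝ} (hX : Measurable X)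
    (hY : Measurable Y) (hXfin : (Set.range X).Finite) (hYfin : (Set.range Y).Finite) :
    ∃ (ι : Type) (_ : Fintype ι) (_ : LinearOrder ι) (_ : MeasurableSpace ι)
      (_ : MeasurableSingletonClass ι) (f : Ω → ι) (x y : ι → ℝ),
      Measurable f ∧ (∀ i, 0 < P.real (f ⁻¹' {i})) ∧ Monotone x ∧ Monotone y ∧
      P.map (fun ω => x (f ω)) = P.map X ∧ P.map (fun ω => y (f ω)) = P.map Y := by
  have : IsProbabilityMeasure (P.map X) := Measure.isProbabilityMeasure_map hX.aemeasurable
  have : IsProbabilityMeasure (P.map Y) := Measure.isProbabilityMeasure_map hY.aemeasurable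
  set ν : Measure ℝ := volume.restrict (Set.Ioo 0 1) with hν
  let q (t : ℝ) : ℝ × ℝ := (quantile (P.map X) t, quantile (P.map Y) t)
  have hq : Measurable q := measurable_quantile.prodMk measurable_quantile
  set S : Set (ℝ × ℝ) := {s | s ∈ Set.range X ×ˢ Set.range Y ∧ 0 < ν (q ⁻¹' {s})} with hS
  have hSfin : S.Finite := (hXfin.prod hYfin).subset fun s hs => hs.1
  have hrange {Z : Ω → ℝ} (hZ : Measurable Z) (hfin : (Set.range Z).Finite)
      [IsProbabilityMeasure (P.map Z)] : ∀ᵐ t ∂ν, quantile (P.map Z) t ∈ Set.range Z := by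
    refine (ae_map_iff (p := (· ∈ Set.range Z)) measurable_quantile.aemeasurable
      hfin.measurableSet).1 ?_
    rw [map_quantile]
    exact (ae_map_iff (p := (· ∈ Set.range Z)) hZ.aemeasurable hfin.measurableSet).2
      (.of_forall fun ω => Set.mem_range_self ω)
  have hqS : ∀ᵐ t ∂ν, q t ∈ S := by
    have hnull : ∀ᵐ t ∂ν, ∀ s ∈ Set.range X ×ˢ Set.range Y, ν (q ⁻¹' {s}) = 0 → q t ≠ s := by
      rw [ae_ball_iff (hXfin.prod hYfin).countable]
      intro s _
      by_cases h0 : ν (q ⁻¹' {s}) = 0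
      · have : ∀ᵐ t ∂ν, t ∉ q ⁻¹' {s} := measure_eq_zero_iff_ae_notMem.1 h0
        filter_upwards [this] with t ht _ h using ht h
      · exact .of_forall fun t h => absurd h h0
    filter_upwards [hrange hX hXfin, hrange hY hYfin, hnull] with t h1 h2 h3
    refine ⟨⟨h1, h2⟩, pos_iff_ne_zero.2 fun h0 => h3 (q t) ⟨h1, h2⟩ h0 rfl⟩
  obtain ⟨t₀, ht₀⟩ := hqS.exists
  have := hSfin.fintype
  classical
  let g (t : ℝ) : S := if h : t ∈ q ⁻¹' S then ⟨q t, h⟩ else ⟨q t₀, ht₀⟩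
  have hg : Measurable g := by
    refine Measurable.dite (s := q ⁻¹' S) (f := fun t => (⟨q t.1, t.2⟩ : S))
      (g := fun _ => ⟨q t₀, ht₀⟩) ?_ measurable_const (hq hSfin.measurableSet)
    exact (hq.comp measurable_subtype_coe).subtype_mk
  have hgq : ∀ᵐ t ∂ν, (g t : ℝ × ℝ) = q t := by
    filter_upwards [hqS] with t ht
    simp [g, ht]
  have hpre (s : S) : ν (g ⁻¹' {s}) = ν (q ⁻¹' {s.1}) := by
    refine measure_congr ?_
    filter_upwards [hgq] with t ht
    refine propext ?_
    change g t = s ↔ q t = s.1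
    rw [← ht, Subtype.ext_iff]
  have : IsProbabilityMeasure (ν.map g) := Measure.isProbabilityMeasure_map hg.aemeasurable
  obtain ⟨f, hf, hfg⟩ := hP.exists_map_eq (ν.map g)
  -- every point of `S` is a value of `q`, and the parameters order `S`
  have hparam (s : S) : ∃ t ∈ Set.Ioo (0 : ℝ) 1, q t = s.1 := by
    have h := s.2.2
    rw [hν, Measure.restrict_apply (hq (measurableSet_singleton _))] at h
    obtain ⟨t, ht1, ht2⟩ := nonempty_of_measure_ne_zero h.ne'
    exact ⟨t, ht2, ht1⟩
  choose τ hτ hqτ using hparam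
  have hτinj : Function.Injective τ := fun s s' h => Subtype.ext (by rw [← hqτ, ← hqτ, h])
  have hlaw (π : ℝ × ℝ → ℝ) (hπ : Measurable π) {Z : Ω → ℝ} [IsProbabilityMeasure (P.map Z)]
      (hqZ : ∀ t, π (q t) = quantile (P.map Z) t) : P.map (fun ω => π (f ω).1) = P.map Z := by
    have hm : Measurable fun s : S => π s.1 := hπ.comp measurable_subtype_coe
    calc P.map (fun ω => π (f ω).1) = (P.map f).map fun s : S => π s.1 :=
          (Measure.map_map hm hf).symm
      _ = ν.map (fun t => π (g t).1) := by rw [hfg, Measure.map_map hm hg]; rfl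
      _ = ν.map (quantile (P.map Z)) := Measure.map_congr (by
          filter_upwards [hgq] with t ht
          rw [ht, hqZ])
      _ = P.map Z := map_quantile
  refine ⟨S, inferInstance, LinearOrder.lift' τ hτinj, inferInstance, inferInstance, f,
    fun s => s.1.1, fun s => s.1.2, hf, fun s => ?_, fun s s' h => ?_, fun s s' h => ?_,
    hlaw Prod.fst measurable_fst fun _ => rfl, hlaw Prod.snd measurable_snd fun _ => rfl⟩
  · rw [measureReal_def, ← Measure.map_apply hf (measurableSet_singleton s), hfg,
      Measure.map_apply hg (measurableSet_singleton s), hpre]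
    exact ENNReal.toReal_pos s.2.2.ne' (measure_ne_top _ _)
  · change s.1.1 ≤ s'.1.1
    rw [← hqτ s, ← hqτ s']
    exact quantile_monotoneOn (hτ s) (hτ s') h
  · change s.1.2 ≤ s'.1.2
    rw [← hqτ s, ← hqτ s']
    exact quantile_monotoneOn (hτ s) (hτ s') h

end Coupling

/-! ### Consistency with the stop-loss order -/

section StopLoss

variable {Ω : Type*} [MeasurableSpace Ω] {P : Measure Ω} [IsProbabilityMeasure P] {p : ℝ≥0∞}
  {r : (Ω → ℝ) → ℝ}

lemma memLp_of_finite_range {X : Ω → ℝ} (hX : Measurable X) (hfin : (Set.range X).Finite) :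
    MemLp X p P := by
  obtain ⟨C, hC⟩ := hfin.isBounded.exists_norm_le
  exact MemLp.of_bound hX.aestronglyMeasurable C (.of_forall fun ω => hC _ ⟨ω, rfl⟩)

/-- The function that equals `|f|` where `|f| ≥ M` and `0` elsewhere. -/
def tail (M : ℝ) (f : Ω → ℝ) : Ω → ℝ := {ω | M ≤ |f ω|}.indicator fun ω => |f ω|

omit [MeasurableSpace Ω] in
lemma tail_nonneg (M : ℝ) (f : Ω → ℝ) (ω : Ω) : 0 ≤ tail M f ω :=
  Set.indicator_nonneg (fun _ _ => abs_nonneg _) ω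

omit [MeasurableSpace Ω] in
lemma tail_of_le {M : ℝ} {f : Ω → ℝ} {ω : Ω} (h : M ≤ |f ω|) : tail M f ω = |f ω| :=
  Set.indicator_of_mem (s := {ω | M ≤ |f ω|}) h _

omit [IsProbabilityMeasure P] in
lemma memLp_tail {f : Ω → ℝ} (hm : Measurable f) (hf : MemLp f p P) (M : ℝ) :
    MemLp (tail M f) p P :=
  hf.abs.indicator (measurableSet_le measurable_const hm.abs)

/-- The tails of an `L^p` function are small in `L^p` and in `L^1`, also for `p = ∞`. -/
lemma exists_tail_le (hp : 1 ≤ p) {f : Ω → ℝ} (hm : Measurable f) (hf : MemLp f p P) {δ : ℝ}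
    (hδ : 0 < δ) : ∃ M₀ : ℝ, ∀ M, M₀ ≤ M →
      (eLpNorm (tail M f) p P).toReal ≤ δ ∧ ∫ ω, tail M f ω ∂P ≤ δ := by
  obtain ⟨M₀, hM₀⟩ := hf.eLpNorm_indicator_norm_ge_le hm.stronglyMeasurable hδ
  refine ⟨M₀, fun M hM => ?_⟩
  have hle : eLpNorm (tail M f) p P ≤ ENNReal.ofReal δ := by
    refine (eLpNorm_mono fun ω => ?_).trans hM₀
    by_cases h : M ≤ |f ω|
    · have h' : ω ∈ {ω | M₀ ≤ ‖f ω‖₊} := hM.trans (by simpa using h)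
      rw [tail_of_le h, Set.indicator_of_mem h', Real.norm_eq_abs, abs_abs, Real.norm_eq_abs]
    · rw [tail, Set.indicator_of_notMem (s := {ω | M ≤ |f ω|}) h, norm_zero]
      exact norm_nonneg _
  have hle1 : eLpNorm (tail M f) 1 P ≤ ENNReal.ofReal δ :=
    (eLpNorm_le_eLpNorm_of_exponent_le hp (memLp_tail hm hf M).aestronglyMeasurable).trans hle
  refine ⟨ENNReal.toReal_le_of_le_ofReal hδ.le hle, ?_⟩
  have hint : ∫ ω, tail M f ω ∂P = (eLpNorm (tail M f) 1 P).toReal := by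
    rw [eLpNorm_one_eq_lintegral_enorm, integral_eq_lintegral_of_nonneg_ae
      (.of_forall (tail_nonneg M f)) (memLp_tail hm hf M).aestronglyMeasurable]
    congr 1
    refine lintegral_congr fun ω => ?_
    rw [← ofReal_norm, Real.norm_of_nonneg (tail_nonneg M f ω)]
  rw [hint]
  exact ENNReal.toReal_le_of_le_ofReal hδ.le hle1

/-- Truncation to `[-M, M]` followed by rounding down to a multiple of `ε`. -/
def roundTrunc (M ε x : ℝ) : ℝ := ε * ⌊max (-M) (min x M) / ε⌋

section roundTrunc

variable {M ε : ℝ}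

lemma measurable_roundTrunc : Measurable (roundTrunc M ε) := by
  unfold roundTrunc
  fun_prop

lemma roundTrunc_le (hε : 0 < ε) (x : ℝ) : roundTrunc M ε x ≤ max (-M) (min x M) := by
  have := Int.floor_le (max (-M) (min x M) / ε)
  rw [le_div_iff₀ hε] at this
  rw [roundTrunc, mul_comm]
  exact this

lemma lt_roundTrunc_add (hε : 0 < ε) (x : ℝ) : max (-M) (min x M) < roundTrunc M ε x + ε := by
  have := Int.lt_floor_add_one (max (-M) (min x M) / ε)
  rw [div_lt_iff₀ hε] at this
  rw [roundTrunc]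
  linarith

lemma finite_range_roundTrunc (hM : 0 ≤ M) (hε : 0 < ε) :
    (Set.range (roundTrunc M ε)).Finite := by
  refine ((Set.finite_Icc ⌊-M / ε⌋ ⌊M / ε⌋).image fun n : ℤ => ε * (n : ℝ)).subset ?_
  rintro _ ⟨x, rfl⟩
  refine ⟨⌊max (-M) (min x M) / ε⌋, ⟨Int.floor_le_floor ?_, Int.floor_le_floor ?_⟩, rfl⟩
  · gcongr
    exact le_max_left _ _
  · gcongr
    exact max_le (by linarith) (min_le_right _ _)

lemma abs_sub_roundTrunc_le {Ω : Type*} (hM : 0 ≤ M) (hε : 0 < ε) (f : Ω → ℝ) (ω : Ω) :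
    |f ω - roundTrunc M ε (f ω)| ≤ ε + tail M f ω := by
  have h1 := roundTrunc_le (M := M) hε (f ω)
  have h2 := lt_roundTrunc_add (M := M) hε (f ω)
  have h3 := tail_nonneg M f ω
  rcases lt_or_ge |f ω| M with h | h
  · obtain ⟨h4, h5⟩ := abs_lt.1 h
    rw [min_eq_left h5.le, max_eq_right h4.le] at h1 h2
    rw [abs_le]
    constructor <;> linarith
  · rw [tail_of_le h]
    rcases le_total 0 (f ω) with h0 | h0
    · rw [abs_of_nonneg h0] at h ⊢
      rw [min_eq_right h, max_eq_right (by linarith)] at h1 h2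
      rw [abs_le]
      constructor <;> linarith
    · rw [abs_of_nonpos h0] at h ⊢
      rw [min_eq_left (by linarith), max_eq_left (by linarith)] at h1 h2
      rw [abs_le]
      constructor <;> linarith

end roundTrunc

namespace IsLawInvariantCoherent

lemma le_of_stopLoss_of_finite_range (hP : IsNonatomic P) (hr : IsLawInvariantCoherent P p r)
    {X Y : Ω → ℝ} (hX : Measurable X) (hY : Measurable Y) (hXfin : (Set.range X).Finite)
    (hYfin : (Set.range Y).Finite)
    (h : ∀ c : ℝ, ∫ ω, max (X ω - c) 0 ∂P ≤ ∫ ω, max (Y ω - c) 0 ∂P) : r X ≤ r Y := by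
  obtain ⟨ι, _, _, _, _, f, x, y, hf, hpos, hx, hy, hxX, hyY⟩ :=
    hP.exists_comonotone hX hY hXfin hYfin
  have hmx : Measurable fun ω => x (f ω) := (measurable_of_finite x).comp hf
  have hmy : Measurable fun ω => y (f ω) := (measurable_of_finite y).comp hf
  have idX : IdentDistrib (fun ω => x (f ω)) X P P := ⟨hmx.aemeasurable, hX.aemeasurable, hxX⟩
  have idY : IdentDistrib (fun ω => y (f ω)) Y P P := ⟨hmy.aemeasurable, hY.aemeasurable, hyY⟩
  rw [← hr.law_invariant (memLp_comp_of_finite hf x) (memLp_of_finite_range hX hXfin) idX,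
    ← hr.law_invariant (memLp_comp_of_finite hf y) (memLp_of_finite_range hY hYfin) idY]
  refine hr.comp_le_comp_of_stopLoss hP hf hpos hx hy fun c => ?_
  have hm : Measurable fun t : ℝ => max (t - c) 0 := by fun_prop
  exact ((idX.comp hm).integral_eq.trans_le (h c)).trans (idY.comp hm).integral_eq.ge

lemma le_add_norm {C : ℝ} (hr : IsLawInvariantCoherent P p r)
    (hC : ∀ f : Ω → ℝ, MemLp f p P → 0 ≤ᵐ[P] f → r f ≤ C * (eLpNorm f p P).toReal)
    (hC0 : 0 ≤ C) {f g e : Ω → ℝ} {a δ : ℝ} (hf : MemLp f p P) (hg : MemLp g p P)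
    (he : MemLp e p P) (he0 : ∀ ω, 0 ≤ e ω) (heδ : (eLpNorm e p P).toReal ≤ δ)
    (h : ∀ ω, f ω ≤ g ω + (a + e ω)) : r f ≤ r g + a + C * δ := by
  have h1 := hr.le_add hf hg (he.add (memLp_const a)) (.of_forall fun ω => by
    simpa [add_comm] using h ω)
  have h2 : r (e + fun _ => a) = r e + a := hr.add_const a he
  have h3 := (hC e he (.of_forall he0)).trans (mul_le_mul_of_nonneg_left heδ hC0)
  linarith

/-- Finite law-invariant coherent risk measures on a nonatomic space are monotone for the stop-loss
order. The larger random variable `g` is only approximated in norm, which is made up for by lowering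
the approximation `X` of `f` by `δ`: this lowers `𝔼[(X - c)⁺]` by at least `δ` times the probability
that `X` is maximal. -/
theorem le_of_stopLoss_of_measurable (hp : 1 ≤ p) (hP : IsNonatomic P)
    (hr : IsLawInvariantCoherent P p r) {f g : Ω → ℝ} (hfm : Measurable f) (hgm : Measurable g)
    (hf : MemLp f p P) (hg : MemLp g p P)
    (h : ∀ c : ℝ, ∫ ω, max (f ω - c) 0 ∂P ≤ ∫ ω, max (g ω - c) 0 ∂P) : r f ≤ r g := by
  have : Fact (1 ≤ p) := ⟨hp⟩
  obtain ⟨C, hC0, hC⟩ := hr.exists_le_norm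
  have hexcess {u : Ω → ℝ} (hu : MemLp u p P) (c : ℝ) : Integrable (fun ω => max (u ω - c) 0) P :=
    ((hu.integrable hp).sub (integrable_const c)).pos_part
  suffices key : ∀ δ : ℝ, 0 < δ → r f ≤ r g + (3 + 3 * C) * δ by
    refine le_of_forall_pos_le_add fun ε hε => ?_
    have := key (ε / (3 + 3 * C)) (by positivity)
    rwa [mul_div_cancel₀ _ (by positivity)] at this
  intro δ hδ
  obtain ⟨M₁, hM₁⟩ := exists_tail_le hp hfm hf hδ
  obtain ⟨M₂, hM₂⟩ := exists_tail_le hp hgm hg hδ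
  set M := max 0 (max M₁ M₂)
  have hM : 0 ≤ M := le_max_left _ _
  have htf := (hM₁ M ((le_max_left _ _).trans (le_max_right _ _))).1
  have htg := (hM₂ M ((le_max_right _ _).trans (le_max_right _ _))).1
  set X : Ω → ℝ := fun ω => roundTrunc M δ (f ω)
  have hXm : Measurable X := measurable_roundTrunc.comp hfm
  have hXfin : (Set.range X).Finite :=
    (finite_range_roundTrunc hM hδ).subset (Set.range_comp_subset_range f (roundTrunc M δ))
  have hX : MemLp X p P := memLp_of_finite_range hXm hXfin
  set g' : Ω → ℝ := fun ω => max (g ω) (-M) with hg'def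
  have hg'm : Measurable g' := hgm.max measurable_const
  have hg' : MemLp g' p P := hg.sup (memLp_const (-M))
  have step1 : r f ≤ r X + δ + C * δ :=
    hr.le_add_norm hC hC0 hf hX (memLp_tail hfm hf M) (tail_nonneg M f) htf fun ω => by
      linarith [(abs_le.1 (abs_sub_roundTrunc_le hM hδ f ω)).2]
  have step4 : r g' ≤ r g + 0 + C * δ :=
    hr.le_add_norm hC hC0 hg' hg (memLp_tail hgm hg M) (tail_nonneg M g) htg fun ω => by
      refine max_le (by linarith [tail_nonneg M g ω]) ?_
      rcases le_total (-M) (g ω) with h1 | h1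
      · linarith [tail_nonneg M g ω]
      · have h2 : |g ω| = -g ω := abs_of_nonpos (by linarith)
        rw [tail_of_le (by linarith), h2]
        linarith
  -- truncation from below preserves the stop-loss order
  have hXg' (c : ℝ) : ∫ ω, max (X ω - c) 0 ∂P ≤ ∫ ω, max (g' ω - c) 0 ∂P := by
    have hid (t : ℝ) : max (max t (-M) - c) 0 = max (t - max c (-M)) 0 + max (-M - c) 0 := by
      rcases le_total c (-M) with h1 | h1 <;> rcases le_total t (-M) with h2 | h2
      · rw [max_eq_right h2, max_eq_right h1, max_eq_right (a := t - -M) (by linarith)]; ring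
      · rw [max_eq_left h2, max_eq_right h1, max_eq_left (by linarith), max_eq_left (by linarith),
          max_eq_left (by linarith)]; ring
      · rw [max_eq_right h2, max_eq_left h1, max_eq_right (a := t - c) (by linarith)]; ring
      · rw [max_eq_left h2, max_eq_left h1, max_eq_right (a := -M - c) (by linarith)]; ring
    calc ∫ ω, max (X ω - c) 0 ∂P ≤ ∫ ω, max (max (f ω) (-M) - c) 0 ∂P := by
          refine integral_mono (hexcess hX c) (hexcess (hf.sup (memLp_const (-M))) c) fun ω => ?_
          have h1 : X ω ≤ max (f ω) (-M) := by
            refine (roundTrunc_le hδ (f ω)).trans ?_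
            rw [max_comm]
            exact max_le_max (min_le_left _ _) le_rfl
          exact max_le_max (by linarith) le_rfl
      _ ≤ ∫ ω, max (g' ω - c) 0 ∂P := by
          simp only [hg'def, hid]
          rw [integral_add (hexcess hf _) (integrable_const _),
            integral_add (hexcess hg _) (integrable_const _)]
          exact add_le_add (h _) le_rfl
  -- the largest value of `X` that is attained with positive probability
  obtain ⟨x, hx, hXx⟩ : ∃ x, 0 < P.real (X ⁻¹' {x}) ∧ ∀ᵐ ω ∂P, X ω ≤ x := by
    have hae : ∀ᵐ ω ∂P, 0 < P.real (X ⁻¹' {X ω}) := by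
      have : ∀ᵐ ω ∂P, ∀ v ∈ Set.range X, P (X ⁻¹' {v}) = 0 → X ω ≠ v := by
        rw [ae_ball_iff hXfin.countable]
        intro v _
        by_cases h0 : P (X ⁻¹' {v}) = 0
        · filter_upwards [measure_eq_zero_iff_ae_notMem.1 h0] with ω hω _ h1 using hω h1
        · exact .of_forall fun _ h1 => absurd h1 h0
      filter_upwards [this] with ω hω
      exact ENNReal.toReal_pos (fun h0 => hω _ ⟨ω, rfl⟩ h0 rfl) (measure_ne_top _ _)
    obtain ⟨ω₀, hω₀⟩ := hae.exists
    have hfin : {v | v ∈ Set.range X ∧ 0 < P.real (X ⁻¹' {v})}.Finite :=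
      hXfin.subset fun v hv => hv.1
    obtain ⟨x, hx, hmax⟩ := Set.exists_max_image _ id hfin ⟨X ω₀, ⟨ω₀, rfl⟩, hω₀⟩
    refine ⟨x, hx.2, ?_⟩
    filter_upwards [hae] with ω hω using hmax _ ⟨⟨ω, rfl⟩, hω⟩
  set q := P.real (X ⁻¹' {x}) with hq
  set η := min δ (δ * q / 2) with hη
  have hη0 : 0 < η := lt_min hδ (by positivity)
  obtain ⟨M₃, hM₃⟩ := exists_tail_le hp hg'm hg' hη0
  set N := max 0 M₃
  have hN : 0 ≤ N := le_max_left _ _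
  obtain ⟨htg', htg'1⟩ := hM₃ N (le_max_right _ _)
  set Y : Ω → ℝ := fun ω => roundTrunc N η (g' ω)
  have hYm : Measurable Y := measurable_roundTrunc.comp hg'm
  have hYfin : (Set.range Y).Finite :=
    (finite_range_roundTrunc hN hη0).subset (Set.range_comp_subset_range g' (roundTrunc N η))
  have hY : MemLp Y p P := memLp_of_finite_range hYm hYfin
  have htail := memLp_tail hg'm hg' N
  have step3 : r Y ≤ r g' + η + C * η :=
    hr.le_add_norm hC hC0 hY hg' htail (tail_nonneg N g') htg' fun ω => by
      linarith [(abs_le.1 (abs_sub_roundTrunc_le hN hη0 g' ω)).1]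
  have step2 : r (fun ω => X ω + -δ) ≤ r Y := by
    refine hr.le_of_stopLoss_of_finite_range hP (hXm.add_const _) hYm
      ((hXfin.image (· + -δ)).subset ?_) hYfin fun c => ?_
    · rintro _ ⟨ω, rfl⟩
      exact ⟨X ω, ⟨ω, rfl⟩, rfl⟩
    rcases le_total x (c + δ) with hxc | hxc
    · have h0 : ∫ ω, max (X ω + -δ - c) 0 ∂P = 0 := by
        refine integral_eq_zero_of_ae ?_
        filter_upwards [hXx] with ω hω
        exact max_eq_right (by linarith)
      rw [h0]
      exact integral_nonneg fun ω => le_max_right _ _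
    · have hXmeas : MeasurableSet (X ⁻¹' {x}) := hXm (measurableSet_singleton x)
      have h1 : ∫ ω, max (X ω + -δ - c) 0 ∂P ≤ ∫ ω, max (X ω - c) 0 ∂P - δ * q := by
        have h2 : ∫ ω, (X ⁻¹' {x}).indicator (fun _ => δ) ω ∂P = δ * q := by
          rw [integral_indicator_const _ hXmeas, smul_eq_mul, mul_comm]
        have hind : Integrable ((X ⁻¹' {x}).indicator fun _ => δ) P :=
          (integrable_const δ).indicator hXmeas
        rw [← h2, ← integral_sub (hexcess hX c) hind]
        refine integral_mono (hexcess (hX.add (memLp_const (-δ))) c) ((hexcess hX c).sub hind)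
          fun ω => ?_
        by_cases hω : ω ∈ X ⁻¹' {x}
        · have hω' : X ω = x := hω
          simp only [Set.indicator_of_mem hω, hω']
          rw [max_eq_left (by linarith), max_eq_left (by linarith)]
          linarith
        · simp only [Set.indicator_of_notMem hω, sub_zero]
          exact max_le_max (by linarith) le_rfl
      have h3 : ∫ ω, max (g' ω - c) 0 ∂P ≤
          ∫ ω, max (Y ω - c) 0 ∂P + (η + ∫ ω, tail N g' ω ∂P) := by
        have hti := htail.integrable hp
        have h4 : ∫ ω, (η + tail N g' ω) ∂P = η + ∫ ω, tail N g' ω ∂P := by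
          rw [integral_add (integrable_const η) hti]
          simp
        have hti' : Integrable (fun ω => η + tail N g' ω) P := (integrable_const η).add hti
        rw [← h4, ← integral_add (hexcess hY c) hti']
        refine integral_mono (hexcess hg' c) ((hexcess hY c).add hti') fun ω => ?_
        have h5 := (abs_le.1 (abs_sub_roundTrunc_le hN hη0 g' ω)).2
        have h6 := tail_nonneg N g' ω
        refine max_le ?_ ?_
        · have := le_max_left (Y ω - c) 0
          linarith
        · have := le_max_right (Y ω - c) 0
          linarith
      have h7 : η ≤ δ * q / 2 := min_le_right _ _
      linarith [hXg' c]
  rw [hr.add_const _ hX] at step2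
  have hηδ : η ≤ δ := min_le_left _ _
  nlinarith [mul_le_mul_of_nonneg_left hηδ hC0]

theorem le_of_stopLoss (hp : 1 ≤ p) (hP : IsNonatomic P) (hr : IsLawInvariantCoherent P p r)
    {f g : Ω → ℝ} (hf : MemLp f p P) (hg : MemLp g p P)
    (h : ∀ c : ℝ, ∫ ω, max (f ω - c) 0 ∂P ≤ ∫ ω, max (g ω - c) 0 ∂P) : r f ≤ r g := by
  have hf' := hf.aestronglyMeasurable.ae_eq_mk
  have hg' := hg.aestronglyMeasurable.ae_eq_mk
  have hf'' := (memLp_congr_ae hf').1 hf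
  have hg'' := (memLp_congr_ae hg').1 hg
  rw [hr.congr hf hf'' hf', hr.congr hg hg'' hg']
  refine hr.le_of_stopLoss_of_measurable hp hP
    hf.aestronglyMeasurable.stronglyMeasurable_mk.measurable
    hg.aestronglyMeasurable.stronglyMeasurable_mk.measurable hf'' hg'' fun c => ?_
  refine ((integral_congr_ae ?_).trans_le (h c)).trans_eq (integral_congr_ae ?_)
  · filter_upwards [hf'] with ω hω
    rw [hω]
  · filter_upwards [hg'] with ω hω
    rw [hω]

end IsLawInvariantCoherent

end StopLoss

/-! ### Deviation measures and the range -/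

section Range

variable {Ω : Type*} [MeasurableSpace Ω] {P : Measure Ω} [IsProbabilityMeasure P] {p : ℝ≥0∞}

lemma integrable_coeFn (hp : 1 ≤ p) (X : Lp ℝ p P) : Integrable X P := (Lp.memLp X).integrable hp

lemma mean_add (hp : 1 ≤ p) (X Y : Lp ℝ p P) : mean P (X + Y) = mean P X + mean P Y := by
  rw [mean, integral_congr_ae (Lp.coeFn_add X Y)]
  exact integral_add (integrable_coeFn hp X) (integrable_coeFn hp Y)

omit [IsProbabilityMeasure P] in
lemma mean_smul (a : ℝ) (X : Lp ℝ p P) : mean P (a • X) = a * mean P X := by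
  rw [mean, integral_congr_ae (Lp.coeFn_smul a X)]
  exact integral_const_mul a X

lemma mean_const (c : ℝ) : mean P (Lp.const p P c) = c := by
  rw [mean, integral_congr_ae (Lp.coeFn_const p P c)]
  simp

lemma mean_mono (hp : 1 ≤ p) {X Y : Lp ℝ p P} (h : ∀ᵐ ω ∂P, X ω ≤ Y ω) : mean P X ≤ mean P Y :=
  integral_mono_ae (integrable_coeFn hp X) (integrable_coeFn hp Y) h

/-- An upper bound of a nonconstant random variable exceeds its mean. -/
lemma IsNonconstant.mean_lt (hp : 1 ≤ p) {X : Lp ℝ p P} (hX : IsNonconstant P X) {e : ℝ}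
    (he : ∀ᵐ ω ∂P, X ω ≤ e) : mean P X < e := by
  have hint : Integrable (fun ω => e - X ω) P := (integrable_const e).sub (integrable_coeFn hp X)
  have hnn : 0 ≤ᵐ[P] fun ω => e - X ω := by
    filter_upwards [he] with ω hω using sub_nonneg.2 hω
  have hval : ∫ ω, (e - X ω) ∂P = e - mean P X := by
    rw [integral_sub (integrable_const e) (integrable_coeFn hp X)]
    simp [mean]
  have h0 : 0 ≤ e - mean P X := hval ▸ integral_nonneg_of_ae hnn
  refine lt_of_le_of_ne (by linarith) fun heq => hX e ?_
  rw [heq, sub_self, integral_eq_zero_iff_of_nonneg_ae hnn hint] at hval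
  refine Lp.ext ?_
  filter_upwards [hval, Lp.coeFn_const p P e] with ω h1 h2
  have h1' : e - X ω = 0 := h1
  rw [h2, Function.const_apply]
  linarith

/-- Division by `ess-sup X - 𝔼[X]` is multiplication by a nonnegative real number, which is `0` if
`X` is not bounded above. -/
lemma IsNonconstant.exists_range_inv (hp : 1 ≤ p) {X : Lp ℝ p P} (hX : IsNonconstant P X) :
    ∃ w : ℝ, (∀ x : ℝ, (x : EReal) / (esssup P X - (mean P X : EReal)) = ((x * w : ℝ) : EReal)) ∧
      ((w = 0 ∧ ∀ e : ℝ, ¬ ∀ᵐ ω ∂P, X ω ≤ e) ∨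
        ∃ e : ℝ, (∀ᵐ ω ∂P, X ω ≤ e) ∧ mean P X < e ∧ w = (e - mean P X)⁻¹ ∧
          ∀ e' : ℝ, (∀ᵐ ω ∂P, X ω ≤ e') → e ≤ e') := by
  have hle : ∀ᵐ ω ∂P, ((X ω : ℝ) : EReal) ≤ esssup P X := ae_le_essSup
  have hmin (e : ℝ) (he : ∀ᵐ ω ∂P, X ω ≤ e) : esssup P X ≤ (e : EReal) :=
    essSup_le_of_ae_le _ (by filter_upwards [he] with ω hω using EReal.coe_le_coe_iff.2 hω)
  induction h : esssup P X with
  | bot =>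
    obtain ⟨ω, hω⟩ := hle.exists
    rw [h] at hω
    exact absurd (le_bot_iff.1 hω) (EReal.coe_ne_bot _)
  | top =>
    refine ⟨0, fun x => ?_, Or.inl ⟨rfl, fun e he => ?_⟩⟩
    · rw [EReal.top_sub_coe, EReal.div_top, mul_zero, EReal.coe_zero]
    · have := hmin e he
      rw [h, top_le_iff] at this
      exact EReal.coe_ne_top _ this
  | coe e =>
    have he : ∀ᵐ ω ∂P, X ω ≤ e := by
      filter_upwards [hle] with ω hω
      rw [h] at hω
      exact EReal.coe_le_coe_iff.1 hω
    refine ⟨(e - mean P X)⁻¹, fun x => ?_, Or.inr ⟨e, he, hX.mean_lt hp he, rfl, fun e' he' => ?_⟩⟩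
    · rw [← EReal.coe_sub, ← EReal.coe_div, div_eq_mul_inv]
    · have := hmin e' he'
      rw [h] at this
      exact EReal.coe_le_coe_iff.1 this

/-- A nonatomic space carries a nonconstant bounded random variable. -/
lemma IsNonatomic.exists_isNonconstant (hP : IsNonatomic P) :
    ∃ Z : Lp ℝ p P, IsNonconstant P Z ∧ ∀ᵐ ω ∂P, Z ω ≤ 1 := by
  obtain ⟨A, -, hA, hA0, hA1⟩ := hP Set.univ .univ (by simp)
  have hco := indicatorConstLp_coeFn (p := p) (μ := P) (hs := hA) (hμs := measure_ne_top P A)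
    (c := (1 : ℝ))
  refine ⟨indicatorConstLp p hA (measure_ne_top P A) 1, fun c hc => ?_, ?_⟩
  · have hae : ∀ᵐ ω ∂P, A.indicator (fun _ => (1 : ℝ)) ω = c := by
      filter_upwards [hco, Lp.coeFn_const p P c] with ω h1 h2
      rw [← h1, hc, h2, Function.const_apply]
    by_cases hc1 : c = 1
    · refine hA1.ne (measure_congr ?_)
      filter_upwards [hae] with ω hω
      refine propext ⟨fun _ => trivial, fun _ => ?_⟩
      by_contra h
      rw [Set.indicator_of_notMem h, hc1] at hω
      exact zero_ne_one hω
    · refine hA0.ne' (measure_eq_zero_iff_ae_notMem.2 ?_)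
      filter_upwards [hae] with ω hω h
      rw [Set.indicator_of_mem h] at hω
      exact hc1 hω.symm
  · filter_upwards [hco] with ω h1
    rw [h1]
    exact Set.indicator_le_self' (fun _ _ => zero_le_one) ω

variable {D : Lp ℝ p P → ℝ≥0}

namespace IsDeviationMeasure

lemma apply_zero (hD : IsDeviationMeasure P D) : D 0 = 0 := by
  simpa using hD.smul 0 0

lemma apply_const (hD : IsDeviationMeasure P D) (c : ℝ) : D (Lp.const p P c) = 0 := by
  simpa [hD.apply_zero] using hD.add_const 0 c

lemma const_mul (hD : IsDeviationMeasure P D) {l : ℝ≥0} (hl : 0 < l) :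
    IsDeviationMeasure P fun X => l * D X where
  add_const X c := by rw [hD.add_const]
  pos X hX := mul_pos hl (hD.pos X hX)
  smul a X := by rw [hD.smul, mul_left_comm]
  add_le X Y := by
    rw [← mul_add]
    gcongr
    exact hD.add_le X Y
  law_invariant X Y h := by rw [hD.law_invariant X Y h]

/-- If the ratios `D(X) / (ess-sup X - 𝔼[X])` are bounded, then some multiple of `D` is range
normalized. -/
lemma exists_isRangeNormalized (hp : 1 ≤ p) (hP : IsNonatomic P) (hD : IsDeviationMeasure P D)
    {K : ℝ} (hK : ∀ X : Lp ℝ p P, IsNonconstant P X → ∀ e : ℝ, (∀ᵐ ω ∂P, X ω ≤ e) →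
      D X ≤ K * (e - mean P X)) :
    ∃ l : ℝ≥0, 0 < l ∧ IsRangeNormalized P fun X => l * D X := by
  set S : Set ℝ := {x | ∃ (X : Lp ℝ p P) (e : ℝ), IsNonconstant P X ∧ (∀ᵐ ω ∂P, X ω ≤ e) ∧
    x = D X / (e - mean P X)} with hS
  obtain ⟨Z, hZ, hZ1⟩ := hP.exists_isNonconstant (p := p)
  have hZS : D Z / (1 - mean P Z) ∈ S := ⟨Z, 1, hZ, hZ1, rfl⟩
  have hbdd : BddAbove S := by
    refine ⟨K, ?_⟩
    rintro _ ⟨X, e, hX, he, rfl⟩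
    rw [div_le_iff₀ (sub_pos.2 (hX.mean_lt hp he))]
    exact hK X hX e he
  set κ := sSup S
  have hκ : 0 < κ := lt_of_lt_of_le
    (div_pos (NNReal.coe_pos.2 (hD.pos Z hZ)) (sub_pos.2 (hZ.mean_lt hp hZ1)))
    (le_csSup hbdd hZS)
  obtain ⟨l, hlκ⟩ : ∃ l : ℝ≥0, (l : ℝ) = κ⁻¹ := ⟨⟨κ⁻¹, (inv_pos.2 hκ).le⟩, rfl⟩
  have hl : 0 < l := NNReal.coe_pos.1 (hlκ ▸ inv_pos.2 hκ)
  refine ⟨l, hl, hD.const_mul hl, le_antisymm ?_ ?_⟩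
  · refine iSup₂_le fun X hX => ?_
    obtain ⟨w, hw, hcase⟩ := hX.exists_range_inv hp
    rw [hw, ← EReal.coe_one, EReal.coe_le_coe_iff]
    rcases hcase with ⟨rfl, -⟩ | ⟨e, he, hlt, rfl, -⟩
    · simp
    · have h1 : D X / (e - mean P X) ≤ κ := le_csSup hbdd ⟨X, e, hX, he, rfl⟩
      rw [NNReal.coe_mul, hlκ, mul_assoc, ← div_eq_mul_inv (D X : ℝ), inv_mul_le_one₀ hκ]
      exact h1
  · refine le_of_forall_lt fun b hb => ?_
    obtain ⟨b', hbb', hb'⟩ := EReal.lt_iff_exists_real_btwn.1 hb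
    rw [← EReal.coe_one, EReal.coe_lt_coe_iff] at hb'
    obtain ⟨x, ⟨X, e', hX, he', rfl⟩, hx⟩ := exists_lt_of_lt_csSup ⟨_, hZS⟩
      (show κ * b' < sSup S by nlinarith)
    refine hbb'.trans_le (le_iSup₂_of_le X hX ?_)
    obtain ⟨w, hw, hcase⟩ := hX.exists_range_inv hp
    rw [hw, EReal.coe_le_coe_iff]
    rcases hcase with ⟨-, hno⟩ | ⟨e, he, hlt, rfl, hmin⟩
    · exact absurd he' (hno e')
    · have h1 : (D X : ℝ) / (e' - mean P X) ≤ D X / (e - mean P X) := by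
        have := sub_pos.2 hlt
        have := hmin e' he'
        gcongr
      rw [NNReal.coe_mul, hlκ, mul_assoc, ← div_eq_mul_inv (D X : ℝ), ← div_eq_inv_mul,
        le_div_iff₀ hκ, mul_comm]
      linarith

end IsDeviationMeasure

namespace IsRangeNormalized

lemma le_sub_mean (hp : 1 ≤ p) (hD : IsRangeNormalized P D) {X : Lp ℝ p P} {e : ℝ}
    (he : ∀ᵐ ω ∂P, X ω ≤ e) : D X ≤ e - mean P X := by
  by_cases hX : IsNonconstant P X
  · have h1 := le_iSup₂ (f := fun (X : Lp ℝ p P) (_ : IsNonconstant P X) =>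
      ((D X : ℝ) : EReal) / (esssup P X - (mean P X : EReal))) X hX
    rw [hD.sup_eq_one] at h1
    obtain ⟨w, hw, hcase⟩ := hX.exists_range_inv hp
    rw [hw, ← EReal.coe_one, EReal.coe_le_coe_iff] at h1
    rcases hcase with ⟨-, hno⟩ | ⟨e', he', hlt, rfl, hmin⟩
    · exact absurd he (hno e)
    · rw [← div_eq_mul_inv, div_le_one (sub_pos.2 hlt)] at h1
      linarith [hmin e he]
  · rw [IsNonconstant] at hX
    push Not at hX
    obtain ⟨c, rfl⟩ := hX
    rw [hD.deviation.apply_const, mean_const]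
    obtain ⟨ω, h1, h2⟩ := (he.and (Lp.coeFn_const p P c)).exists
    rw [h2, Function.const_apply] at h1
    simpa using h1

/-- Since the supremum in range normalization is at least `1`, a bound `s D(X) ≤ d (e - 𝔼[X])` for
all upper bounds `e` forces `s ≤ d`. -/
lemma le_of_forall_mul_le (hp : 1 ≤ p) (hD : IsRangeNormalized P D) {s d : ℝ} (hd : 0 ≤ d)
    (h : ∀ X : Lp ℝ p P, IsNonconstant P X → ∀ e : ℝ, (∀ᵐ ω ∂P, X ω ≤ e) →
      s * D X ≤ d * (e - mean P X)) : s ≤ d := by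
  rcases le_or_gt s 0 with hs | hs
  · exact hs.trans hd
  have h1 : (1 : EReal) ≤ ((d / s : ℝ) : EReal) := by
    rw [← hD.sup_eq_one]
    refine iSup₂_le fun X hX => ?_
    obtain ⟨w, hw, hcase⟩ := hX.exists_range_inv hp
    rw [hw, EReal.coe_le_coe_iff]
    rcases hcase with ⟨rfl, -⟩ | ⟨e, he, hlt, rfl, -⟩
    · rw [mul_zero]; positivity
    · rw [← div_eq_mul_inv, div_le_div_iff₀ (sub_pos.2 hlt) hs, mul_comm]
      exact h X hX e he
  rw [← EReal.coe_one, EReal.coe_le_coe_iff, one_le_div hs] at h1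
  exact h1

lemma mean_add_le_mean_add (hp : 1 ≤ p) (hD : IsRangeNormalized P D) {X Y : Lp ℝ p P}
    (h : ∀ᵐ ω ∂P, X ω ≤ Y ω) : mean P X + D X ≤ mean P Y + D Y := by
  have h1 : D X ≤ D Y + D (X - Y) := by simpa using hD.deviation.add_le Y (X - Y)
  have h2 : mean P X = mean P Y + mean P (X - Y) := by
    rw [← mean_add hp]
    simp
  have h3 := hD.le_sub_mean hp (X := X - Y) (e := 0) (by
    filter_upwards [h, Lp.coeFn_sub X Y] with ω h1 h2
    rw [h2, Pi.sub_apply]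
    linarith)
  have h4 : (D X : ℝ) ≤ D Y + D (X - Y) := by exact_mod_cast h1
  linarith

end IsRangeNormalized

end Range

/-! ### Consistency with second-order stochastic dominance -/

section SSD

variable {Ω : Type*} [MeasurableSpace Ω] {P : Measure Ω} [IsProbabilityMeasure P] {p : ℝ≥0∞}
  {D : Lp ℝ p P → ℝ≥0}

open Classical in
/-- The functional `𝔼 + D` on functions, with value `0` outside `L^p`. -/
def meanAddDeviation (D : Lp ℝ p P → ℝ≥0) (f : Ω → ℝ) : ℝ :=
  if hf : MemLp f p P then mean P (hf.toLp f) + D (hf.toLp f) else 0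

omit [IsProbabilityMeasure P] in
lemma meanAddDeviation_of_memLp {f : Ω → ℝ} (hf : MemLp f p P) :
    meanAddDeviation D f = mean P (hf.toLp f) + D (hf.toLp f) := dif_pos hf

lemma IsRangeNormalized.isLawInvariantCoherent (hp : 1 ≤ p) (hD : IsRangeNormalized P D) :
    IsLawInvariantCoherent P p (meanAddDeviation D) where
  mono {f g} hf hg h := by
    rw [meanAddDeviation_of_memLp hf, meanAddDeviation_of_memLp hg]
    refine hD.mean_add_le_mean_add hp ?_
    filter_upwards [h, hf.coeFn_toLp, hg.coeFn_toLp] with ω h1 h2 h3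
    rwa [h2, h3]
  add_const {f} c hf := by
    have h1 : (hf.add (memLp_const c)).toLp (fun ω => f ω + c) = hf.toLp f + Lp.const p P c := rfl
    rw [meanAddDeviation_of_memLp (f := fun ω => f ω + c) (hf.add (memLp_const c)),
      meanAddDeviation_of_memLp hf, h1, mean_add hp, mean_const, hD.deviation.add_const]
    ring
  smul {f a} ha hf := by
    have h1 : (hf.const_mul a).toLp (fun ω => a * f ω) = a • hf.toLp f := rfl
    lift a to ℝ≥0 using ha
    rw [meanAddDeviation_of_memLp (hf.const_mul a), meanAddDeviation_of_memLp hf, h1, mean_smul,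
      hD.deviation.smul, NNReal.coe_mul]
    ring
  add_le {f g} hf hg := by
    have h1 : (hf.add hg).toLp (fun ω => f ω + g ω) = hf.toLp f + hg.toLp g := rfl
    rw [meanAddDeviation_of_memLp (f := fun ω => f ω + g ω) (hf.add hg),
      meanAddDeviation_of_memLp hf, meanAddDeviation_of_memLp hg, h1, mean_add hp]
    have h2 : (D (hf.toLp f + hg.toLp g) : ℝ) ≤ D (hf.toLp f) + D (hg.toLp g) := by
      exact_mod_cast hD.deviation.add_le _ _
    linarith
  law_invariant {f g} hf hg h := by
    have h1 : IdentDistrib (hf.toLp f) (hg.toLp g) P P :=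
      ((IdentDistrib.of_ae_eq hf.aestronglyMeasurable.aemeasurable hf.coeFn_toLp.symm).symm.trans
        h).trans (IdentDistrib.of_ae_eq hg.aestronglyMeasurable.aemeasurable hg.coeFn_toLp.symm)
    rw [meanAddDeviation_of_memLp hf, meanAddDeviation_of_memLp hg,
      hD.deviation.law_invariant _ _ h1, mean, mean, h1.integral_eq]

omit [IsProbabilityMeasure P] in
lemma extendedMean_of_integrable {f : Ω → ℝ} (hf : Integrable f P) :
    extendedMean P f = ((∫ ω, f ω ∂P : ℝ) : EReal) := by
  have h1 : ∫⁻ ω, ENNReal.ofReal (f ω) ∂P ≠ ⊤ := hf.lintegral_lt_top.ne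
  have h2 : ∫⁻ ω, ENNReal.ofReal (-f ω) ∂P ≠ ⊤ := hf.neg.lintegral_lt_top.ne
  rw [extendedMean, integral_eq_lintegral_pos_part_sub_lintegral_neg_part hf, EReal.coe_sub,
    EReal.coe_ennreal_toReal h1, EReal.coe_ennreal_toReal h2]

lemma SSDLe.integral_le (hp : 1 ≤ p) {X Y : Lp ℝ p P} (h : SSDLe P X Y) (c : ℝ) :
    ∫ ω, max (X ω - c) 0 ∂P ≤ ∫ ω, max (Y ω - c) 0 ∂P := by
  have hint (Z : Lp ℝ p P) : Integrable (fun ω => max (Z ω - c) 0) P :=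
    ((integrable_coeFn hp Z).sub (integrable_const c)).pos_part
  have hconv : ConvexOn ℝ Set.univ fun t : ℝ => max (t - c) 0 :=
    ((convexOn_id convex_univ).sub (concaveOn_const c convex_univ)).sup
      (convexOn_const 0 convex_univ)
  have := h (fun t => max (t - c) 0) (fun s t hst => max_le_max (by linarith) le_rfl) hconv
  rwa [extendedMean_of_integrable (hint X), extendedMean_of_integrable (hint Y),
    EReal.coe_le_coe_iff] at this

lemma SSDLe.mean_le (hp : 1 ≤ p) {X Y : Lp ℝ p P} (h : SSDLe P X Y) : mean P X ≤ mean P Y := by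
  have := h id monotone_id (convexOn_id convex_univ)
  rwa [extendedMean_of_integrable (f := fun ω => id (X ω)) (integrable_coeFn hp X),
    extendedMean_of_integrable (f := fun ω => id (Y ω)) (integrable_coeFn hp Y),
    EReal.coe_le_coe_iff] at this

theorem IsRangeNormalized.mean_add_le_of_ssdLe (hp : 1 ≤ p) (hP : IsNonatomic P)
    (hD : IsRangeNormalized P D) {X Y : Lp ℝ p P} (h : SSDLe P X Y) :
    mean P X + D X ≤ mean P Y + D Y := by
  have := (hD.isLawInvariantCoherent hp).le_of_stopLoss hp hP (Lp.memLp X) (Lp.memLp Y)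
    (h.integral_le hp)
  rwa [meanAddDeviation_of_memLp (Lp.memLp X), meanAddDeviation_of_memLp (Lp.memLp Y),
    Lp.toLp_coeFn, Lp.toLp_coeFn] at this

/-- If the mean and `𝔼 + λ D` both increase, then so does `g(D) + 𝔼` for increasing `λ`-Lipschitz
`g`: only the case where `D` decreases needs the Lipschitz bound. -/
lemma comp_add_le_of_lipschitz {l : ℝ≥0} {g : ℝ≥0 → ℝ} (hg : Monotone g) (hgl : LipschitzWith l g)
    {d d' : ℝ≥0} {m m' : ℝ} (hm : m ≤ m') (h : m + l * d ≤ m' + l * d') : g d + m ≤ g d' + m' := by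
  rcases le_total d d' with hd | hd
  · exact add_le_add (hg hd) hm
  · have h1 := hgl.dist_le_mul d d'
    rw [Real.dist_eq, NNReal.dist_eq, abs_of_nonneg (sub_nonneg.2 (hg hd)),
      abs_of_nonneg (sub_nonneg.2 (NNReal.coe_le_coe.2 hd))] at h1
    linarith

end SSD

/-! ### Mean-deviation models -/

section Model

variable {Ω : Type*} [MeasurableSpace Ω] {P : Measure Ω} [IsProbabilityMeasure P] {p : ℝ≥0∞}
  {D : Lp ℝ p P → ℝ≥0} {U : Lp ℝ p P → WithTop ℝ} {V : ℝ → ℝ≥0 → WithTop ℝ}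

/-- `a • Z + b` realizes any prescribed deviation `d`. -/
lemma IsDeviationMeasure.apply_smul_add (hD : IsDeviationMeasure P D) {Z : Lp ℝ p P}
    (hZ : IsNonconstant P Z) (d : ℝ≥0) (b : ℝ) :
    D (((d / D Z : ℝ≥0) : ℝ) • Z + Lp.const p P b) = d := by
  rw [hD.add_const, hD.smul, div_mul_cancel₀ _ (hD.pos Z hZ).ne']

lemma coeFn_smul_add_const (a b : ℝ) (Z : Lp ℝ p P) :
    ∀ᵐ ω ∂P, (a • Z + Lp.const p P b) ω = a * Z ω + b := by
  filter_upwards [Lp.coeFn_add (a • Z) (Lp.const p P b), Lp.coeFn_smul a Z,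
    Lp.coeFn_const p P b] with ω h1 h2 h3
  rw [h1, Pi.add_apply, h2, h3]
  rfl

/-- Comparing the constant `m` with a multiple of `Z - e` plus a constant, where `Z ≤ e`, bounds
`V` from above. -/
lemma aggregator_le (hp : 1 ≤ p) (hD : IsDeviationMeasure P D) (hV : IsAggregator V)
    (hUV : ∀ X, U X = V (mean P X) (D X)) (hU : IsMonotonic P U) {Z : Lp ℝ p P}
    (hZ : IsNonconstant P Z) {e : ℝ} (he : ∀ᵐ ω ∂P, Z ω ≤ e) (m : ℝ) (d : ℝ≥0) :
    V m d ≤ ((m + d / D Z * (e - mean P Z) : ℝ) : WithTop ℝ) := by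
  set a : ℝ := ((d / D Z : ℝ≥0) : ℝ) with ha
  set b : ℝ := m - a * mean P Z with hb
  have ha0 : 0 ≤ a := NNReal.coe_nonneg _
  have h1 := hU (a • Z + Lp.const p P b) (Lp.const p P (a * e + b)) (by
    filter_upwards [coeFn_smul_add_const a b Z, Lp.coeFn_const p P (a * e + b), he]
      with ω h1 h2 h3
    rw [h1, h2, Function.const_apply]
    gcongr)
  have hmean : mean P (a • Z + Lp.const p P b) = m := by
    rw [mean_add hp, mean_smul, mean_const, hb]; ring
  rw [hUV, hUV, hD.apply_smul_add hZ, hmean, hD.apply_const, mean_const, hV.apply_zero] at h1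
  refine h1.trans_eq ?_
  rw [hb, ha, NNReal.coe_div]
  congr 1
  ring

lemma aggregator_ne_top (hp : 1 ≤ p) (hP : IsNonatomic P) (hD : IsDeviationMeasure P D)
    (hV : IsAggregator V) (hUV : ∀ X, U X = V (mean P X) (D X)) (hU : IsMonotonic P U) (m : ℝ)
    (d : ℝ≥0) : V m d ≠ ⊤ := by
  obtain ⟨Z, hZ, hZ1⟩ := hP.exists_isNonconstant (p := p)
  exact ne_top_of_le_ne_top WithTop.coe_ne_top (aggregator_le hp hD hV hUV hU hZ hZ1 m d)

/-- Unbounded ratios `D(X) / (ess-sup X - 𝔼[X])` would force `V m d = m`. -/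
lemma exists_isRangeNormalized_of_isMonotonic (hp : 1 ≤ p) (hP : IsNonatomic P)
    (hD : IsDeviationMeasure P D) (hV : IsAggregator V)
    (hUV : ∀ X, U X = V (mean P X) (D X)) (hU : IsMonotonic P U) :
    ∃ l : ℝ≥0, 0 < l ∧ IsRangeNormalized P fun X => l * D X := by
  obtain ⟨m, d, hmd⟩ : ∃ m d, V m d ≠ (m : WithTop ℝ) := by
    obtain ⟨m, d₁, d₂, hne⟩ := hV.depends_on_deviation
    by_contra! h
    exact hne ((h m d₁).trans (h m d₂).symm)
  have hge : (m : WithTop ℝ) ≤ V m d := by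
    rw [← hV.apply_zero m]
    exact hV.mono_right m zero_le
  obtain ⟨v, hv⟩ := WithTop.ne_top_iff_exists.1 (aggregator_ne_top hp hP hD hV hUV hU m d)
  have hmv : m < v := by
    rw [← hv] at hmd hge
    exact lt_of_le_of_ne (WithTop.coe_le_coe.1 hge) fun h => hmd (by rw [h])
  refine hD.exists_isRangeNormalized hp hP (K := d / (v - m)) fun X hX e he => ?_
  have h1 := aggregator_le hp hD hV hUV hU hX he m d
  rw [← hv, WithTop.coe_le_coe] at h1
  have hDX : (0 : ℝ) < D X := NNReal.coe_pos.2 (hD.pos X hX)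
  have h2 : v - m ≤ d * (e - mean P X) / D X := by
    rw [mul_div_right_comm]
    linarith
  rw [le_div_iff₀ hDX] at h2
  rw [div_mul_eq_mul_div, le_div_iff₀ (sub_pos.2 hmv)]
  linarith

/-- A monetary mean-deviation model is the mean plus a Lipschitz function of the deviation. -/
lemma exists_lipschitz_of_isMonetary (hp : 1 ≤ p) (hP : IsNonatomic P)
    (hD : IsDeviationMeasure P D) (hV : IsAggregator V)
    (hUV : ∀ X, U X = V (mean P X) (D X)) (hU : IsMonetary P U) {l : ℝ≥0}
    (hlD : IsRangeNormalized P fun X => l * D X) :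
    ∃ g : ℝ≥0 → ℝ, (∃ x y, g x ≠ g y) ∧ Monotone g ∧ LipschitzWith l g ∧ g 0 = 0 ∧
      ∀ X, U X = ((g (D X) + mean P X : ℝ) : WithTop ℝ) := by
  have htop := aggregator_ne_top hp hP hD hV hUV hU.1
  obtain ⟨Z₀, hZ₀, -⟩ := hP.exists_isNonconstant (p := p)
  set g : ℝ≥0 → ℝ := fun d => (V 0 d).untop (htop 0 d) with hg
  have hgV (d : ℝ≥0) : ((g d : ℝ) : WithTop ℝ) = V 0 d := WithTop.coe_untop _ _
  have hVg (m : ℝ) (d : ℝ≥0) : V m d = ((g d + m : ℝ) : WithTop ℝ) := by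
    set a : ℝ := ((d / D Z₀ : ℝ≥0) : ℝ)
    set X := a • Z₀ + Lp.const p P (-(a * mean P Z₀)) with hX
    have hDX : D X = d := hD.apply_smul_add hZ₀ d _
    have hmX : mean P X = 0 := by
      rw [hX, mean_add hp, mean_smul, mean_const]; ring
    have h1 := hU.2 X m
    rw [hUV, hUV, hD.add_const, hDX, mean_add hp, mean_const, hmX, zero_add, ← hgV d] at h1
    rw [h1, WithTop.coe_add]
  have hmono : Monotone g := fun x y hxy => by
    have := hV.mono_right 0 hxy
    simp only [← hgV] at this
    exact WithTop.coe_le_coe.1 this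
  refine ⟨g, ?_, hmono, ?_, ?_, fun X => ?_⟩
  · obtain ⟨m, d₁, d₂, hne⟩ := hV.depends_on_deviation
    refine ⟨d₁, d₂, fun h => hne ?_⟩
    rw [hVg, hVg, h]
  · have key (d ε : ℝ≥0) : g (d + ε) - g d ≤ l * ε := by
      refine hlD.le_of_forall_mul_le hp (by positivity) fun Z hZ e he => ?_
      have hDZ : (0 : ℝ) < D Z := NNReal.coe_pos.2 (hD.pos Z hZ)
      set a : ℝ := (((d + ε) / D Z : ℝ≥0) : ℝ) with ha
      set b : ℝ := ((d / D Z : ℝ≥0) : ℝ) with hb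
      have hab : a = b + ε / D Z := by
        rw [ha, hb, NNReal.coe_div, NNReal.coe_div, NNReal.coe_add, add_div]
      -- scaling `Z` up from deviation `d` to `d + ε` adds at most `ε * e / D Z`
      have h1 := hU.1 (a • Z + Lp.const p P 0) (b • Z + Lp.const p P (ε / D Z * e)) (by
        filter_upwards [coeFn_smul_add_const a 0 Z, coeFn_smul_add_const b (ε / D Z * e) Z, he]
          with ω h1 h2 h3
        have : (ε : ℝ) / D Z * Z ω ≤ ε / D Z * e := by gcongr
        rw [h1, h2, hab]
        linarith)
      rw [hUV, hUV, hD.apply_smul_add hZ, hD.apply_smul_add hZ, hVg, hVg, WithTop.coe_le_coe,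
        mean_add hp, mean_add hp, mean_smul, mean_smul, mean_const, mean_const, hab] at h1
      have h2 : g (d + ε) - g d ≤ ε * (e - mean P Z) / D Z := by
        rw [mul_div_right_comm]
        linarith
      rw [le_div_iff₀ hDZ] at h2
      rw [NNReal.coe_mul]
      have := mul_le_mul_of_nonneg_left h2 l.coe_nonneg
      linarith
    refine LipschitzWith.of_le_add_mul l fun x y => ?_
    rw [NNReal.dist_eq]
    rcases le_total x y with hxy | hxy
    · have := hmono hxy
      have : 0 ≤ (l : ℝ) * |(x : ℝ) - y| := by positivity
      linarith
    · have := key y (x - y)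
      rw [add_tsub_cancel_of_le hxy, NNReal.coe_sub hxy] at this
      rw [abs_of_nonneg (sub_nonneg.2 (NNReal.coe_le_coe.2 hxy))]
      linarith
  · have := hgV 0
    rw [hV.apply_zero] at this
    exact WithTop.coe_injective this
  · rw [hUV, hVg]

lemma isConsistent_of_lipschitz (hp : 1 ≤ p) (hP : IsNonatomic P)
    (hD : IsDeviationMeasure P D) {l : ℝ≥0} (hlD : IsRangeNormalized P fun X => l * D X)
    {g : ℝ≥0 → ℝ} (hg : Monotone g) (hgl : LipschitzWith l g)
    (hU : ∀ X, U X = ((g (D X) + mean P X : ℝ) : WithTop ℝ)) : IsConsistent P U := by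
  refine ⟨⟨fun X Y h => ?_, fun X c => ?_⟩, fun X Y h => ?_⟩
  · rw [hU, hU, WithTop.coe_le_coe]
    refine comp_add_le_of_lipschitz hg hgl (mean_mono hp h) ?_
    simpa using hlD.mean_add_le_mean_add hp h
  · rw [hU, hU, hD.add_const, mean_add hp, mean_const, ← WithTop.coe_add, add_assoc]
  · rw [hU, hU, WithTop.coe_le_coe]
    refine comp_add_le_of_lipschitz hg hgl (h.mean_le hp) ?_
    simpa using hlD.mean_add_le_of_ssdLe hp hP h

end Model

end MeanDeviation

end

theorem theorem1 {Ω : Type*} [MeasurableSpace Ω] (P : MeasureTheory.Measure Ω)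
    [MeasureTheory.IsProbabilityMeasure P] (hP : MeanDeviation.IsNonatomic P)
    (p : ℝ≥0∞) (hp : 1 ≤ p)
    (D : MeasureTheory.Lp ℝ p P → ℝ≥0) (U : MeasureTheory.Lp ℝ p P → WithTop ℝ)
    (hU : MeanDeviation.IsMeanDeviationModel P D U) :
    List.TFAE [
      MeanDeviation.IsMonetary P U,
      MeanDeviation.IsConsistent P U,
      ∃ l : ℝ≥0, 0 < l ∧ MeanDeviation.IsRangeNormalized P (fun X => l * D X) ∧
        ∃ g : ℝ≥0 → ℝ, (∃ x y, g x ≠ g y) ∧ Monotone g ∧ LipschitzWith l g ∧ g 0 = 0 ∧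
          ∀ X, U X = ((g (D X) + MeanDeviation.mean P X : ℝ) : WithTop ℝ)] ∧
    (MeanDeviation.IsMonotonic P U →
      (∀ X, U X < ⊤) ∧
        ∃ l : ℝ≥0, 0 < l ∧ MeanDeviation.IsRangeNormalized P (fun X => l * D X)) := by
  obtain ⟨hD, V, hV, hUV⟩ := hU
  refine ⟨?_, fun hm => ⟨fun X => ?_, ?_⟩⟩
  · tfae_have 1 → 3 := fun h => by
      obtain ⟨l, hl, hlD⟩ :=
        MeanDeviation.exists_isRangeNormalized_of_isMonotonic hp hP hD hV hUV h.1
      exact ⟨l, hl, hlD, MeanDeviation.exists_lipschitz_of_isMonetary hp hP hD hV hUV h hlD⟩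
    tfae_have 3 → 2 := fun ⟨l, _, hlD, g, _, hg, hgl, _, hUg⟩ =>
      MeanDeviation.isConsistent_of_lipschitz hp hP hD hlD hg hgl hUg
    tfae_have 2 → 1 := fun h => h.1
    tfae_finish
  · rw [hUV]
    exact (MeanDeviation.aggregator_ne_top hp hP hD hV hUV hm _ _).lt_top
  · exact MeanDeviation.exists_isRangeNormalized_of_isMonotonic hp hP hD hV hUV hm
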